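/- Let $n_1,n_2\ge 1$ and $0\le k_1\le k_2$ be integers, $n=n_1+n_2$, and let $V_1,V_2$ be disjoint sets of $n_1$ and $n_2$ nodes (nodes of type 1 and of type 2). A network consists of two disjoint sets $\mathcal E_P$ (protected links) and $\mathcal E_{NP}$ (non-protected links) of unordered pairs of distinct nodes of $V_1\cup V_2$. It is $(k_1,k_2)$-resistant if, for every $\mathcal E_A\subseteq\mathcal E_{NP}$: (a) if $|\mathcal E_A|\le k_1$, any two nodes of $V_1\cup V_2$ are joined by a path in the graph $(V_1\cup V_2,\ \mathcal E_P\cup\mathcal E_{NP}\setminus\mathcal E_A)$; (b) if $|\mathcal E_A|\le k_2$, any two nodes of $V_2$ are joined by a path in that graph. Given unit costs $c_P>0$ and $c_{NP}>0$, a $(k_1,k_2)$-resistant network is optimal if it minimizes $c_P|\mathcal E_P|+c_{NP}|\mathcal E_{NP}|$ among all $(k_1,k_2)$-resistant networks on these nodes. An $s^D_p$ is a $(k_1,k_2)$-resistant network with exactly $p$ protected links which, among all such networks, has the minimum number of non-protected links. "The $s^D_p$ are optimal" means that networks $s^D_p$ exist and that each of them is optimal. Assume $n_1\ge k_1+1$,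 $n_2\ge k_2-k_1+1$, $n_2\frac{k_1+1}{2}\le n_1$, $k_1$ odd and $n_2(k_2+1)$ even. Then every optimal network is an $s^D_0$, an $s^D_{n_2-1}$ or an $s^D_{n-1}$. Moreover: I) (Regime I) Suppose $1+k_1-n(k_2-k_1)\le 0$. (1) If $2\frac{c_P}{c_{NP}}\ge k_2+1+\frac{k_2-k_1}{n_2-1}$, then the $s^D_0$ are optimal. (2) If $k_1+1+\frac{k_1+1}{n_1}\le 2\frac{c_P}{c_{NP}}<k_2+1+\frac{k_2-k_1}{n_2-1}$, then the $s^D_{n_2-1}$ are optimal. (3) If $2\frac{c_P}{c_{NP}}<k_1+1+\frac{k_1+1}{n_1}$, then the $s^D_{n-1}$ are optimal. If $2\frac{c_P}{c_{NP}}$ is different from both thresholds, there are no other optimal networks. II) (Regime II) Suppose $1+k_1-n(k_2-k_1)>0$. (1) If $n_2<\frac{1+k_1}{1+k_1-n_1(k_2-k_1)}$, then the conclusions of I) hold. (2) If $n_2\ge\frac{1+k_1}{1+k_1-n_1(k_2-k_1)}$, then: (i) if $2\frac{c_P}{c_{NP}}\ge\frac{n_1(k_1+1)+n_2(k_2+1)}{n_1+n_2-1}$,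 the $s^D_0$ are optimal; (ii) if $2\frac{c_P}{c_{NP}}<\frac{n_1(k_1+1)+n_2(k_2+1)}{n_1+n_2-1}$, the $s^D_{n-1}$ are optimal. If $2\frac{c_P}{c_{NP}}$ is different from this threshold, there are no other optimal networks. If $n_2\ge 2$, no $s^D_{n_2-1}$ is optimal, whatever the costs. -/

import Mathlib

/-- The devices of the two-layer network: `Sum.inl i` are the `n₁` devices of type 1 and
`Sum.inr j` are the `n₂` devices of type 2. -/
abbrev Device (n₁ n₂ : ℕ) : Type := Fin n₁ ⊕ Fin n₂

/-- A two-layer network on `n₁ + n₂` devices: a set of protected links and a disjoint set of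
non-protected links, where a link is an unordered pair of distinct devices. -/
structure TwoLayerNetwork (n₁ n₂ : ℕ) where
  /-- the protected links -/
  prot : Finset (Sym2 (Device n₁ n₂))
  /-- the non-protected links -/
  nonprot : Finset (Sym2 (Device n₁ n₂))
  prot_loopless : ∀ e ∈ prot, ¬ e.IsDiag
  nonprot_loopless : ∀ e ∈ nonprot, ¬ e.IsDiag
  disjoint : Disjoint prot nonprot

namespace TwoLayerNetwork

variable {n₁ n₂ : ℕ}

/-- The graph that is left after the non-protected links in `A` have been removed. -/
def surviving (s : TwoLayerNetwork n₁ n₂) (A : Finset (Sym2 (Device n₁ n₂))) :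
    SimpleGraph (Device n₁ n₂) :=
  SimpleGraph.fromEdgeSet
    ((s.prot : Set (Sym2 (Device n₁ n₂))) ∪
      ((s.nonprot : Set (Sym2 (Device n₁ n₂))) \ (A : Set (Sym2 (Device n₁ n₂)))))

/-- `(k₁, k₂)`-resistance: after an attack on at most `k₁` non-protected links any two devices
are still joined by a path, and after an attack on at most `k₂` non-protected links any two
devices of type 2 are still joined by a path (through devices of either type). -/
def Resistant (k₁ k₂ : ℕ) (s : TwoLayerNetwork n₁ n₂) : Prop :=
  (∀ A : Finset (Sym2 (Device n₁ n₂)), A ⊆ s.nonprot → A.card ≤ k₁ →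
    ∀ i j : Device n₁ n₂, (s.surviving A).Reachable i j) ∧
  (∀ A : Finset (Sym2 (Device n₁ n₂)), A ⊆ s.nonprot → A.card ≤ k₂ →
    ∀ i j : Fin n₂, (s.surviving A).Reachable (Sum.inr i) (Sum.inr j))

/-- The cost of a network, with `cP` per protected and `cNP` per non-protected link. -/
def cost (cP cNP : ℝ) (s : TwoLayerNetwork n₁ n₂) : ℝ :=
  cP * (s.prot.card : ℝ) + cNP * (s.nonprot.card : ℝ)

/-- `s` is an optimal strategy: it is `(k₁, k₂)`-resistant and has the least cost among all
`(k₁, k₂)`-resistant networks on the same devices. -/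
def IsOptimal (k₁ k₂ : ℕ) (cP cNP : ℝ) (s : TwoLayerNetwork n₁ n₂) : Prop :=
  s.Resistant k₁ k₂ ∧
    ∀ t : TwoLayerNetwork n₁ n₂, t.Resistant k₁ k₂ → s.cost cP cNP ≤ t.cost cP cNP

/-- `s` is an `s^D_p`: a `(k₁, k₂)`-resistant network with exactly `p` protected links and, among
all such networks, the minimum number of non-protected links. -/
def IsSD (k₁ k₂ p : ℕ) (s : TwoLayerNetwork n₁ n₂) : Prop :=
  s.Resistant k₁ k₂ ∧ s.prot.card = p ∧
    ∀ t : TwoLayerNetwork n₁ n₂, t.Resistant k₁ k₂ → t.prot.card = p →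
      s.nonprot.card ≤ t.nonprot.card

end TwoLayerNetwork

/-- "The `s^D_p` are optimal strategies": networks `s^D_p` exist, and each one is optimal. -/
def SDOptimal (n₁ n₂ k₁ k₂ : ℕ) (cP cNP : ℝ) (p : ℕ) : Prop :=
  (∃ s : TwoLayerNetwork n₁ n₂, s.IsSD k₁ k₂ p) ∧
    ∀ s : TwoLayerNetwork n₁ n₂, s.IsSD k₁ k₂ p → s.IsOptimal k₁ k₂ cP cNP

/-- "The `s^D_p` are the only optimal strategies": every optimal network is an `s^D_p`. -/
def OnlySDOptimal (n₁ n₂ k₁ k₂ : ℕ) (cP cNP : ℝ) (p : ℕ) : Prop :=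
  ∀ s : TwoLayerNetwork n₁ n₂, s.IsOptimal k₁ k₂ cP cNP → s.IsSD k₁ k₂ p

/-- The rule with two thresholds for the choice between `s^D_0`, `s^D_{n₂-1}` and `s^D_{n-1}`,
where `n = n₁ + n₂`. -/
def TwoThresholdRule (n₁ n₂ k₁ k₂ : ℕ) (cP cNP : ℝ) : Prop :=
  -- expensive protection
  ((k₂ : ℝ) + 1 + ((k₂ : ℝ) - k₁) / ((n₂ : ℝ) - 1) ≤ 2 * (cP / cNP) →
    SDOptimal n₁ n₂ k₁ k₂ cP cNP 0) ∧
  -- intermediate cost of protection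
  ((k₁ : ℝ) + 1 + ((k₁ : ℝ) + 1) / (n₁ : ℝ) ≤ 2 * (cP / cNP) →
    2 * (cP / cNP) < (k₂ : ℝ) + 1 + ((k₂ : ℝ) - k₁) / ((n₂ : ℝ) - 1) →
    SDOptimal n₁ n₂ k₁ k₂ cP cNP (n₂ - 1)) ∧
  -- cheap protection
  (2 * (cP / cNP) < (k₁ : ℝ) + 1 + ((k₁ : ℝ) + 1) / (n₁ : ℝ) →
    SDOptimal n₁ n₂ k₁ k₂ cP cNP (n₁ + n₂ - 1)) ∧
  -- away from the thresholds there are no other optimal strategies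
  ((k₂ : ℝ) + 1 + ((k₂ : ℝ) - k₁) / ((n₂ : ℝ) - 1) < 2 * (cP / cNP) →
    OnlySDOptimal n₁ n₂ k₁ k₂ cP cNP 0) ∧
  ((k₁ : ℝ) + 1 + ((k₁ : ℝ) + 1) / (n₁ : ℝ) < 2 * (cP / cNP) →
    2 * (cP / cNP) < (k₂ : ℝ) + 1 + ((k₂ : ℝ) - k₁) / ((n₂ : ℝ) - 1) →
    OnlySDOptimal n₁ n₂ k₁ k₂ cP cNP (n₂ - 1)) ∧
  (2 * (cP / cNP) < (k₁ : ℝ) + 1 + ((k₁ : ℝ) + 1) / (n₁ : ℝ) →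
    OnlySDOptimal n₁ n₂ k₁ k₂ cP cNP (n₁ + n₂ - 1))

/-- The rule with one threshold for the choice between `s^D_0` and `s^D_{n-1}`; networks
`s^D_{n₂-1}` are never optimal (when `n₂ = 1` they coincide with the `s^D_0`). -/
def OneThresholdRule (n₁ n₂ k₁ k₂ : ℕ) (cP cNP : ℝ) : Prop :=
  (((n₁ : ℝ) * ((k₁ : ℝ) + 1) + (n₂ : ℝ) * ((k₂ : ℝ) + 1)) / ((n₁ : ℝ) + (n₂ : ℝ) - 1)
      ≤ 2 * (cP / cNP) →
    SDOptimal n₁ n₂ k₁ k₂ cP cNP 0) ∧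
  (2 * (cP / cNP) <
      ((n₁ : ℝ) * ((k₁ : ℝ) + 1) + (n₂ : ℝ) * ((k₂ : ℝ) + 1)) / ((n₁ : ℝ) + (n₂ : ℝ) - 1) →
    SDOptimal n₁ n₂ k₁ k₂ cP cNP (n₁ + n₂ - 1)) ∧
  (2 ≤ n₂ → ∀ s : TwoLayerNetwork n₁ n₂,
    s.IsSD k₁ k₂ (n₂ - 1) → ¬ s.IsOptimal k₁ k₂ cP cNP) ∧
  -- away from the threshold there are no other optimal strategies
  (((n₁ : ℝ) * ((k₁ : ℝ) + 1) + (n₂ : ℝ) * ((k₂ : ℝ) + 1)) / ((n₁ : ℝ) + (n₂ : ℝ) - 1)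
      < 2 * (cP / cNP) →
    OnlySDOptimal n₁ n₂ k₁ k₂ cP cNP 0) ∧
  (2 * (cP / cNP) <
      ((n₁ : ℝ) * ((k₁ : ℝ) + 1) + (n₂ : ℝ) * ((k₂ : ℝ) + 1)) / ((n₁ : ℝ) + (n₂ : ℝ) - 1) →
    OnlySDOptimal n₁ n₂ k₁ k₂ cP cNP (n₁ + n₂ - 1))

/-! Resistance is a statement about cuts: an attack on `k` links cannot separate `i` from `j`
exactly when every cut between them is crossed by a protected link or by at least `k + 1`
non-protected ones (`reachable_of_cut`, `lt_card_cut`).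

Lower bound. Contract the `p` protected links. At least `n - p` classes remain, `c₁` without and
`c₂` with nodes of type 2. As soon as there are two classes, each is a cut without protected links,
so at least `k₁ + 1` of the `q` non-protected links cross it, and at least `k₂ + 1` if the class has
type 2 and `c₂ ≥ 2`. A link crosses at most two classes, which bounds `2q`
(`Resistant.exists_contraction_bound`). With `r = 2 cP / cNP`, the quantity to minimize is `r p +
2q`. The bounds are linear in `(c₁, c₂)`, so the candidates are the corners `(n₁, n₂)`, `(n₁, 1)`
and `(0, 1)`, that is `p = 0`, `n₂ - 1`, `n - 1`; every other `p` costs strictly more than one of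
the three corner values (`Resistant.scaledCost_lower_bound`). If `k₁ = k₂`, the middle corner drops
out.

Attainment. Put `m = (k₁ + 1) / 2`. A protected spanning star serves for `p = n - 1`. For `p = n₂ -
1`, take a protected star on `V₂` and a circulant graph with steps `1, …, m`, which is
`2m`-edge-connected, on `V₁` and the centre. For `p = 0`, take such a circulant on all nodes, with
the type 2 nodes spaced `m + 1` apart, and add about `n₂ d / 2` links inside `V₂`, where `d = k₂ -
k₁`. For odd `d` these include an antipodal matching, and a cut that splits no antipodal pair may be
one link short; but it then meets the circle in two distant places, and the circulant supplies the
missing link (`two_mul_lt_card_cut_of_matching`).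

The thresholds are the values of `r` at which two corner values agree. -/

/-- The link `e` joins a node of `S` to a node outside `S`. -/
def Crosses {V : Type*} (S : Set V) (e : Sym2 V) : Prop :=
  ∃ u ∈ S, ∃ v ∉ S, e = s(u, v)

open scoped Classical in
/-- The links of `E` that cross the cut `S`. -/
noncomputable def cut {V : Type*} (E : Finset (Sym2 V)) (S : Set V) : Finset (Sym2 V) :=
  E.filter (Crosses S)

theorem mem_cut {V : Type*} {E : Finset (Sym2 V)} {S : Set V} {e : Sym2 V} :
    e ∈ cut E S ↔ e ∈ E ∧ Crosses S e := by
  simp [cut]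

theorem crosses_mk {V : Type*} {S : Set V} {u v : V} :
    Crosses S s(u, v) ↔ (u ∈ S ∧ v ∉ S) ∨ (v ∈ S ∧ u ∉ S) := by
  constructor
  · rintro ⟨a, ha, b, hb, h⟩
    rcases Sym2.eq_iff.1 h with ⟨rfl, rfl⟩ | ⟨rfl, rfl⟩
    · exact Or.inl ⟨ha, hb⟩
    · exact Or.inr ⟨ha, hb⟩
  · rintro (⟨h, h'⟩ | ⟨h, h'⟩)
    · exact ⟨u, h, v, h', rfl⟩
    · exact ⟨v, h, u, h', Sym2.eq_swap⟩

theorem crosses_compl {V : Type*} {S : Set V} {e : Sym2 V} :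
    Crosses Sᶜ e ↔ Crosses S e := by
  induction e using Sym2.ind with
  | _ u v => simp only [crosses_mk, Set.mem_compl_iff]; tauto

theorem crosses_map {V W : Type*} (f : V → W) {S : Set W} {e : Sym2 V} :
    Crosses S (e.map f) ↔ Crosses (f ⁻¹' S) e := by
  induction e using Sym2.ind with
  | _ u v => simp only [Sym2.map_mk, crosses_mk, Set.mem_preimage]

theorem cut_compl {V : Type*} (E : Finset (Sym2 V)) (S : Set V) : cut E Sᶜ = cut E S := by
  ext e
  simp only [mem_cut, crosses_compl]

/-! ### Resistance in terms of cuts -/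

/-- If every cut between `i` and `j` is crossed by a protected link or by more than `k` links,
then no attack on `k` links disconnects `i` from `j`. -/
theorem TwoLayerNetwork.reachable_of_cut {n₁ n₂ k : ℕ} (s : TwoLayerNetwork n₁ n₂)
    {i j : Device n₁ n₂}
    (h : ∀ S : Set (Device n₁ n₂), i ∈ S → j ∉ S →
      (∃ e ∈ s.prot, Crosses S e) ∨ k + 1 ≤ (cut s.nonprot S).card)
    (A : Finset (Sym2 (Device n₁ n₂))) (hA : A.card ≤ k) : (s.surviving A).Reachable i j := by
  by_contra hij
  -- The set of nodes still reachable from `i` is a cut that no surviving link crosses.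
  have key : ∀ e : Sym2 (Device n₁ n₂), Crosses {v | (s.surviving A).Reachable i v} e →
      e ∉ s.prot ∧ (e ∈ s.nonprot → e ∈ A) := by
    rintro _ ⟨u, hu, v, hv, rfl⟩
    by_contra hcon
    refine hv (SimpleGraph.Reachable.trans hu (SimpleGraph.Adj.reachable ?_))
    rw [surviving, SimpleGraph.fromEdgeSet_adj]
    refine ⟨?_, ?_⟩
    · simp only [Set.mem_union, Finset.mem_coe, Set.mem_sdiff]
      tauto
    · rintro rfl
      exact hv hu
  rcases h {v | (s.surviving A).Reachable i v} (SimpleGraph.Reachable.refl i) hij with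
    ⟨e, he, hc⟩ | hc
  · exact (key e hc).1 he
  · have : (cut s.nonprot {v | (s.surviving A).Reachable i v}).card ≤ A.card := by
      refine Finset.card_le_card fun e he => ?_
      rw [mem_cut] at he
      exact (key e he.2).2 he.1
    omega

/-- A cut that separates two nodes which survive every attack on `k` links, and that is crossed
by no protected link, is crossed by more than `k` links. -/
theorem TwoLayerNetwork.lt_card_cut {n₁ n₂ k : ℕ} (s : TwoLayerNetwork n₁ n₂)
    {i j : Device n₁ n₂}
    (h : ∀ A : Finset (Sym2 (Device n₁ n₂)), A ⊆ s.nonprot → A.card ≤ k →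
      (s.surviving A).Reachable i j)
    {S : Set (Device n₁ n₂)} (hi : i ∈ S) (hj : j ∉ S) (hS : ∀ e ∈ s.prot, ¬ Crosses S e) :
    k + 1 ≤ (cut s.nonprot S).card := by
  by_contra hcon
  -- Attack precisely the links of the cut; a surviving walk from `i` to `j` would have to cross it.
  obtain ⟨w⟩ := h (cut s.nonprot S) (fun e he => (mem_cut.1 he).1) (by omega)
  obtain ⟨d, -, hd1, hd2⟩ := w.exists_boundary_dart S hi hj
  have hadj := (SimpleGraph.fromEdgeSet_adj _).1 d.adj
  have hc : Crosses S s(d.fst, d.snd) := ⟨_, hd1, _, hd2, rfl⟩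
  rcases hadj.1 with hp | ⟨hp, hq⟩
  · exact hS _ hp hc
  · exact hq (mem_cut.2 ⟨hp, hc⟩)

/-! ### Lower bound by contraction of the protected links -/

/-- Contracting `p` links leaves at least `|V| - p` nodes. -/
theorem exists_contraction {V : Type*} [Fintype V] [DecidableEq V] (P : Finset (Sym2 V)) :
    ∃ f : V → V, (∀ u v, s(u, v) ∈ P → f u = f v) ∧
      Fintype.card V ≤ P.card + (Finset.univ.image f).card := by
  induction P using Finset.induction_on with
  | empty => exact ⟨id, by simp, by simp⟩
  | insert e P he ih =>
    obtain ⟨f, hf, hc⟩ := ih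
    induction e using Sym2.ind with
    | _ a b =>
      -- The class of `b` is merged into that of `a`, so the image loses at most the value `f b`.
      refine ⟨fun v => if f v = f b then f a else f v, ?_, ?_⟩
      · intro u v huv
        rcases Finset.mem_insert.1 huv with h | h
        · rcases Sym2.eq_iff.1 h with ⟨rfl, rfl⟩ | ⟨rfl, rfl⟩
          · simp
          · simp
        · simp only [hf u v h]
      · rw [Finset.card_insert_of_notMem he]
        have hsub : (Finset.univ.image f).erase (f b) ⊆
            Finset.univ.image (fun v => if f v = f b then f a else f v) := by
          intro y hy
          obtain ⟨hy1, hy2⟩ := Finset.mem_erase.1 hy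
          obtain ⟨v, -, rfl⟩ := Finset.mem_image.1 hy2
          exact Finset.mem_image.2 ⟨v, Finset.mem_univ _, if_neg hy1⟩
        have h1 := Finset.card_le_card hsub
        have h2 := Finset.pred_card_le_card_erase (s := Finset.univ.image f) (a := f b)
        omega

/-- Every link crosses at most two of the fibres of a map. -/
theorem sum_card_cut_fiber_le {V : Type*} [DecidableEq V] (f : V → V) (E : Finset (Sym2 V))
    (T : Finset V) : ∑ t ∈ T, (cut E (f ⁻¹' {t})).card ≤ 2 * E.card := by
  classical
  have h1 : ∀ t ∈ T, (cut E (f ⁻¹' {t})).card =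
      ∑ e ∈ E, if Crosses (f ⁻¹' {t}) e then 1 else 0 := by
    intro t _
    rw [cut, Finset.card_filter]
  rw [Finset.sum_congr rfl h1, Finset.sum_comm, mul_comm, ← smul_eq_mul]
  refine Finset.sum_le_card_nsmul _ _ _ fun e _ => ?_
  rw [← Finset.card_filter]
  induction e using Sym2.ind with
  | _ u v =>
    refine (Finset.card_le_card (t := {f u, f v}) fun t ht => ?_).trans Finset.card_le_two
    have := (Finset.mem_filter.1 ht).2
    simp only [crosses_mk, Set.mem_preimage, Set.mem_singleton_iff] at this
    simp only [Finset.mem_insert, Finset.mem_singleton]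
    rcases this with h | h
    · exact Or.inl h.1.symm
    · exact Or.inr h.1.symm

/-- The lower bound for the number of non-protected links: contracting the protected links leaves
`c₁` nodes without and `c₂` nodes with devices of type 2. -/
theorem TwoLayerNetwork.Resistant.exists_contraction_bound {n₁ n₂ k₁ k₂ : ℕ} (hn₂ : 1 ≤ n₂)
    {s : TwoLayerNetwork n₁ n₂} (hs : s.Resistant k₁ k₂) :
    ∃ c₁ c₂ : ℕ, c₁ ≤ n₁ ∧ 1 ≤ c₂ ∧ c₂ ≤ n₂ ∧ n₁ + n₂ ≤ s.prot.card + (c₁ + c₂) ∧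
      (2 ≤ c₂ → c₁ * (k₁ + 1) + c₂ * (k₂ + 1) ≤ 2 * s.nonprot.card) ∧
      (c₂ = 1 → 1 ≤ c₁ → (c₁ + 1) * (k₁ + 1) ≤ 2 * s.nonprot.card) := by
  classical
  obtain ⟨f, hf, hcard⟩ := exists_contraction s.prot
  have hprot : ∀ t : Device n₁ n₂, ∀ e ∈ s.prot, ¬ Crosses (f ⁻¹' {t}) e := by
    rintro t e he ⟨u, hu, v, hv, rfl⟩
    have := hf u v he
    simp only [Set.mem_preimage, Set.mem_singleton_iff] at hu hv
    exact hv (this ▸ hu)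
  set T₂ : Finset (Device n₁ n₂) := Finset.univ.image fun j : Fin n₂ => f (Sum.inr j) with hT₂
  set T₁ : Finset (Device n₁ n₂) := Finset.univ.image f \ T₂ with hT₁
  have hsub : T₂ ⊆ Finset.univ.image f := by
    intro t ht
    obtain ⟨j, -, rfl⟩ := Finset.mem_image.1 ht
    exact Finset.mem_image_of_mem _ (Finset.mem_univ _)
  have hc : T₁.card + T₂.card = (Finset.univ.image f).card :=
    Finset.card_sdiff_add_card_eq_card hsub
  have hT₁le : T₁.card ≤ n₁ := by
    have : T₁ ⊆ Finset.univ.image fun i : Fin n₁ => f (Sum.inl i) := by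
      intro t ht
      obtain ⟨h1, h2⟩ := Finset.mem_sdiff.1 ht
      obtain ⟨v, -, rfl⟩ := Finset.mem_image.1 h1
      rcases v with i | j
      · exact Finset.mem_image_of_mem _ (Finset.mem_univ _)
      · exact absurd (Finset.mem_image_of_mem _ (Finset.mem_univ j)) h2
    simpa using (Finset.card_le_card this).trans Finset.card_image_le
  have hT₂le : T₂.card ≤ n₂ := by
    simpa using (Finset.card_image_le (s := Finset.univ) (f := fun j : Fin n₂ => f (Sum.inr j)))
  have hT₂pos : 1 ≤ T₂.card :=
    Finset.card_pos.2 ⟨f (Sum.inr ⟨0, hn₂⟩), Finset.mem_image_of_mem _ (Finset.mem_univ _)⟩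
  have hn : Fintype.card (Device n₁ n₂) = n₁ + n₂ := by simp
  -- A second class makes the fibre a proper cut. For the stronger bound `k₂ + 1`, the second class
  -- must contain a node of type 2 as well.
  have hcut₁ : ∀ t ∈ Finset.univ.image f, 2 ≤ (Finset.univ.image f).card →
      k₁ + 1 ≤ (cut s.nonprot (f ⁻¹' {t})).card := by
    intro t ht h2
    obtain ⟨t', ht', hne⟩ := Finset.exists_mem_ne h2 t
    obtain ⟨u, -, hu⟩ := Finset.mem_image.1 ht
    obtain ⟨v, -, hv⟩ := Finset.mem_image.1 ht'
    refine s.lt_card_cut (i := u) (j := v) (fun A hA hk => hs.1 A hA hk u v) hu ?_ (hprot t)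
    simp only [Set.mem_preimage, Set.mem_singleton_iff, hv]
    exact hne
  have hcut₂ : ∀ t ∈ T₂, 2 ≤ T₂.card → k₂ + 1 ≤ (cut s.nonprot (f ⁻¹' {t})).card := by
    intro t ht h2
    obtain ⟨t', ht', hne⟩ := Finset.exists_mem_ne h2 t
    obtain ⟨u, -, hu⟩ := Finset.mem_image.1 ht
    obtain ⟨v, -, hv⟩ := Finset.mem_image.1 ht'
    refine s.lt_card_cut (i := Sum.inr u) (j := Sum.inr v) (fun A hA hk => hs.2 A hA hk u v)
      hu ?_ (hprot t)
    simp only [Set.mem_preimage, Set.mem_singleton_iff, hv]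
    exact hne
  have hsum := sum_card_cut_fiber_le f s.nonprot (Finset.univ.image f)
  refine ⟨T₁.card, T₂.card, hT₁le, hT₂pos, hT₂le, by omega, fun h2 => ?_, fun h1 h1' => ?_⟩
  · rw [← Finset.sum_sdiff hsub] at hsum
    have e1 := Finset.card_nsmul_le_sum T₁ (fun t => (cut s.nonprot (f ⁻¹' {t})).card) (k₁ + 1)
      fun t ht => hcut₁ t (Finset.mem_sdiff.1 ht).1 (by omega)
    have e2 := Finset.card_nsmul_le_sum T₂ (fun t => (cut s.nonprot (f ⁻¹' {t})).card) (k₂ + 1)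
      fun t ht => hcut₂ t ht h2
    simp only [smul_eq_mul] at e1 e2
    exact (add_le_add e1 e2).trans hsum
  · have e1 := Finset.card_nsmul_le_sum (Finset.univ.image f)
      (fun t => (cut s.nonprot (f ⁻¹' {t})).card) (k₁ + 1) fun t ht => hcut₁ t ht (by omega)
    rw [smul_eq_mul, ← hc, h1] at e1
    exact e1.trans hsum

/-! ### Edge connectivity of circulant graphs -/

theorem natCast_zmod_ne_zero {N j : ℕ} (h1 : 1 ≤ j) (h2 : j < N) : (j : ZMod N) ≠ 0 := by
  rw [Ne, ZMod.natCast_eq_zero_iff]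
  exact fun h => absurd (Nat.le_of_dvd h1 h) (by omega)

theorem natCast_zmod_inj {N i j : ℕ} (hi : i < N) (hj : j < N) (h : (i : ZMod N) = (j : ZMod N)) :
    i = j :=
  Nat.ModEq.eq_of_lt_of_lt ((ZMod.natCast_eq_natCast_iff _ _ _).1 h) hi hj

/-- Walking upwards from `a ∈ S` to `b ∉ S`, one leaves `S` somewhere. -/
theorem exists_boundary_between {N : ℕ} {S : Set (ZMod N)} {a b : ℕ} (hab : a ≤ b)
    (ha : (a : ZMod N) ∈ S) (hb : (b : ZMod N) ∉ S) :
    ∃ c : ℕ, a ≤ c ∧ c < b ∧ (c : ZMod N) ∈ S ∧ (c : ZMod N) + 1 ∉ S := by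
  induction b, hab using Nat.le_induction with
  | base => exact absurd ha hb
  | succ b hab ih =>
    by_cases h : (b : ZMod N) ∈ S
    · exact ⟨b, hab, by omega, h, by exact_mod_cast hb⟩
    · obtain ⟨c, h1, h2, h3, h4⟩ := ih h
      exact ⟨c, h1, by omega, h3, h4⟩

/-- The links of the circulant graph on `ℤ/N` with steps `1, …, m`. -/
def circulantLinks (N m : ℕ) [NeZero N] : Finset (Sym2 (ZMod N)) :=
  (Finset.univ ×ˢ Finset.Icc 1 m).image fun p : ZMod N × ℕ => s(p.1, p.1 + (p.2 : ZMod N))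

section Circulant

variable {N m : ℕ} [NeZero N]

theorem mem_circulantLinks {e : Sym2 (ZMod N)} :
    e ∈ circulantLinks N m ↔ ∃ (a : ZMod N) (j : ℕ), 1 ≤ j ∧ j ≤ m ∧ e = s(a, a + (j : ZMod N)) := by
  simp only [circulantLinks, Finset.mem_image, Finset.mem_product, Finset.mem_univ, true_and,
    Finset.mem_Icc, Prod.exists]
  constructor
  · rintro ⟨a, j, h, rfl⟩
    exact ⟨a, j, h.1, h.2, rfl⟩
  · rintro ⟨a, j, h, h', rfl⟩
    exact ⟨a, j, ⟨h, h'⟩, rfl⟩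

theorem not_isDiag_of_mem_circulantLinks (hN : m < N) {e : Sym2 (ZMod N)}
    (he : e ∈ circulantLinks N m) : ¬ e.IsDiag := by
  obtain ⟨a, j, h1, h2, rfl⟩ := mem_circulantLinks.1 he
  rw [Sym2.mk_isDiag_iff]
  intro h
  exact natCast_zmod_ne_zero h1 (by omega) (left_eq_add.1 h)

theorem card_circulantLinks_le : (circulantLinks N m).card ≤ N * m := by
  refine Finset.card_image_le.trans ?_
  simp [ZMod.card]

theorem mk_mem_circulantLinks {t : ℤ} {x z : ZMod N} (ht1 : -(m : ℤ) ≤ t) (ht2 : t ≤ m)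
    (hz : z = x + t) (hne : z ≠ x) : s(z, x) ∈ circulantLinks N m := by
  rcases lt_trichotomy t 0 with h | rfl | h
  · refine mem_circulantLinks.2 ⟨z, (-t).toNat, by omega, by omega, ?_⟩
    have : (((-t).toNat : ℤ) : ZMod N) = ((-t : ℤ) : ZMod N) := by
      rw [Int.toNat_of_nonneg (by omega)]
    rw [Int.cast_natCast] at this
    rw [this, hz]
    push_cast
    rw [add_neg_cancel_right]
  · simp [hz] at hne
  · refine mem_circulantLinks.2 ⟨x, t.toNat, by omega, by omega, ?_⟩
    have : ((t.toNat : ℤ) : ZMod N) = (t : ZMod N) := by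
      rw [Int.toNat_of_nonneg (by omega)]
    rw [Int.cast_natCast] at this
    rw [this, ← hz, Sym2.eq_swap]

/-- For a fixed step `j`, translation by `j` preserves the size of `S`, so as many links leave `S`
as enter it. Since `2 * m < N`, each link has a unique start and step, and the counts for different
`j` add up. -/
theorem even_card_cut_circulantLinks (hN : 2 * m + 1 ≤ N) (S : Set (ZMod N)) :
    Even (cut (circulantLinks N m) S).card := by
  classical
  have hinj : Set.InjOn (fun p : ZMod N × ℕ => s(p.1, p.1 + (p.2 : ZMod N)))
      ((Finset.univ ×ˢ Finset.Icc 1 m : Finset (ZMod N × ℕ)) : Set (ZMod N × ℕ)) := by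
    rintro ⟨a, j⟩ hp ⟨b, k⟩ hq h
    simp only [Finset.coe_product, Set.mem_prod, Finset.mem_coe, Finset.mem_Icc, Finset.mem_univ,
      true_and] at hp hq
    rcases Sym2.eq_iff.1 h with ⟨h1, h2⟩ | ⟨h1, h2⟩
    · simp only at h1 h2
      subst h1
      rw [natCast_zmod_inj (by omega) (by omega) (add_left_cancel h2)]
    · exfalso
      simp only at h1 h2
      refine natCast_zmod_ne_zero (N := N) (j := j + k) (by omega) (by omega) ?_
      push_cast
      rw [h1] at h2
      linear_combination h2
  have h1 : (cut (circulantLinks N m) S).card =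
      ∑ j ∈ Finset.Icc 1 m, (Finset.univ.filter fun a : ZMod N =>
        Crosses S s(a, a + (j : ZMod N))).card := by
    have : cut (circulantLinks N m) S = ((Finset.univ ×ˢ Finset.Icc 1 m).filter
        fun p : ZMod N × ℕ => Crosses S s(p.1, p.1 + (p.2 : ZMod N))).image
          fun p => s(p.1, p.1 + (p.2 : ZMod N)) := by
      ext e
      simp only [mem_cut, circulantLinks, Finset.mem_image, Finset.mem_filter]
      constructor
      · rintro ⟨⟨p, hp, rfl⟩, h⟩
        exact ⟨p, ⟨hp, h⟩, rfl⟩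
      · rintro ⟨p, ⟨hp, h⟩, rfl⟩
        exact ⟨⟨p, hp, rfl⟩, h⟩
    rw [this, Finset.card_image_of_injOn (hinj.mono (Finset.coe_subset.2 (Finset.filter_subset _ _))),
      Finset.card_filter, Finset.sum_product_right]
    exact Finset.sum_congr rfl fun j _ => (Finset.card_filter _ _).symm
  rw [h1]
  refine Finset.even_sum _ fun j _ => ?_
  set U := Finset.univ.filter fun a : ZMod N => a ∈ S with hU
  set W := Finset.univ.filter fun a : ZMod N => a + (j : ZMod N) ∈ S with hW
  have hUW : W.card = U.card := by
    refine Finset.card_bij (fun a _ => a + (j : ZMod N)) ?_ ?_ ?_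
    · intro a ha
      simpa [hU, hW] using ha
    · intro a _ b _ h
      exact add_right_cancel h
    · intro b hb
      exact ⟨b - j, by simpa [hU, hW] using hb, by simp⟩
  have h2 : (Finset.univ.filter fun a : ZMod N => Crosses S s(a, a + (j : ZMod N))) =
      (U \ W) ∪ (W \ U) := by
    ext a
    simp [hU, hW, crosses_mk]
  rw [h2, Finset.card_union_of_disjoint disjoint_sdiff_sdiff, Finset.card_sdiff_comm hUW]
  exact ⟨_, rfl⟩

/-- At a boundary point of `S`, there are `2m - 1` crossing links of the circulant graph. -/
theorem exists_boundary_links (hm : 1 ≤ m) (hN : 2 * m + 1 ≤ N) {S : Set (ZMod N)} {x : ZMod N}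
    (hx : x ∈ S) (hx' : x + 1 ∉ S) :
    ∃ L : Finset (Sym2 (ZMod N)), L ⊆ cut (circulantLinks N m) S ∧ 2 * m - 1 ≤ L.card ∧
      ∀ e ∈ L, x ∈ e ∨ x + 1 ∈ e := by
  classical
  -- The window `x + 1 - m, …, x + m` consists of points within `m` steps of both `x` and `x + 1`.
  set Wd : Finset (ZMod N) := (Finset.range (2 * m)).image fun i : ℕ => x + 1 - m + i with hWd
  have hWc : Wd.card = 2 * m := by
    rw [hWd, Finset.card_image_of_injOn, Finset.card_range]
    intro i hi j hj h
    simp only [Finset.coe_range, Set.mem_Iio] at hi hj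
    exact natCast_zmod_inj (by omega) (by omega) (add_left_cancel h)
  set T := Wd \ {x, x + 1} with hT
  have hTc : 2 * m - 2 ≤ T.card := by
    have h1 := Finset.le_card_sdiff {x, x + 1} Wd
    rw [← hT] at h1
    have h2 : ({x, x + 1} : Finset (ZMod N)).card ≤ 2 := Finset.card_le_two
    omega
  have hTx : ∀ z ∈ T, z ≠ x ∧ z ≠ x + 1 := by
    intro z hz
    have := (Finset.mem_sdiff.1 hz).2
    simpa [not_or] using this
  -- Each `z` is linked to whichever of `x ∈ S` and `x + 1 ∉ S` lies on the other side. The `2m - 2`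
  -- links from the window and the link `s(x, x + 1)` make `2m - 1`.
  set g : ZMod N → Sym2 (ZMod N) := fun z => if z ∈ S then s(z, x + 1) else s(z, x) with hg
  have hgmem : ∀ z, z ∈ g z := by
    intro z
    simp only [hg]
    split_ifs <;> simp
  have hgsub : ∀ z w, w ∈ g z → w = z ∨ w = x ∨ w = x + 1 := by
    intro z w
    simp only [hg]
    split_ifs <;> simp only [Sym2.mem_iff] <;> tauto
  refine ⟨insert s(x, x + 1) (T.image g), ?_, ?_, ?_⟩
  · intro e he
    rcases Finset.mem_insert.1 he with rfl | he
    · refine mem_cut.2 ⟨mem_circulantLinks.2 ⟨x, 1, le_rfl, hm, by simp⟩, x, hx, x + 1, hx', rfl⟩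
    · obtain ⟨z, hz, rfl⟩ := Finset.mem_image.1 he
      obtain ⟨hz1, hz2⟩ := hTx z hz
      obtain ⟨i, hi, rfl⟩ := Finset.mem_image.1 (Finset.mem_sdiff.1 hz).1
      rw [Finset.mem_range] at hi
      simp only [hg]
      split_ifs with h
      · refine mem_cut.2 ⟨mk_mem_circulantLinks (t := (i : ℤ) - m) (by omega) (by omega) ?_ hz2,
          _, h, _, hx', rfl⟩
        push_cast
        ring
      · refine mem_cut.2 ⟨mk_mem_circulantLinks (t := (i : ℤ) + 1 - m) (by omega) (by omega) ?_ hz1,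
          _, hx, _, h, Sym2.eq_swap⟩
        push_cast
        ring
  · rw [Finset.card_insert_of_notMem, Finset.card_image_of_injOn]
    · omega
    · intro z hz w hw h
      have h1 := hgsub w z (h ▸ hgmem z)
      have h2 := hTx z hz
      tauto
    · intro h
      obtain ⟨z, hz, h⟩ := Finset.mem_image.1 h
      have h1 := hgmem z
      rw [h, Sym2.mem_iff] at h1
      have h2 := hTx z hz
      tauto
  · intro e he
    rcases Finset.mem_insert.1 he with rfl | he
    · exact Or.inl (Sym2.mem_mk_left _ _)
    · obtain ⟨z, hz, rfl⟩ := Finset.mem_image.1 he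
      simp only [hg]
      split_ifs <;> simp

theorem exists_boundary {S : Set (ZMod N)} {a b : ZMod N} (ha : a ∈ S) (hb : b ∉ S) :
    ∃ x ∈ S, x + 1 ∉ S := by
  have h1 : ((a.val : ℕ) : ZMod N) ∈ S := by rwa [ZMod.natCast_zmod_val]
  -- Adding `N` places the representative of `b` above that of `a`, so that the upward walk exists.
  have h2 : ((b.val + N : ℕ) : ZMod N) ∉ S := by
    push_cast
    rwa [ZMod.natCast_zmod_val, ZMod.natCast_self, add_zero]
  obtain ⟨c, -, -, h3, h4⟩ := exists_boundary_between (by have := ZMod.val_lt a; omega) h1 h2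
  exact ⟨_, h3, h4⟩

/-- The circulant graph with steps `1, …, m` is `2m`-edge-connected. -/
theorem two_mul_le_card_cut_circulantLinks (hN : 2 * m + 1 ≤ N) {S : Set (ZMod N)}
    {a b : ZMod N} (ha : a ∈ S) (hb : b ∉ S) :
    2 * m ≤ (cut (circulantLinks N m) S).card := by
  rcases Nat.eq_zero_or_pos m with rfl | hm
  · simp
  · obtain ⟨x, hx, hx'⟩ := exists_boundary ha hb
    -- This gives only `2m - 1` links; parity supplies the last one.
    obtain ⟨L, hL, hc, -⟩ := exists_boundary_links hm hN hx hx'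
    have h1 := Finset.card_le_card hL
    obtain ⟨r, hr⟩ := even_card_cut_circulantLinks hN S
    omega

/-- Translation by `1` preserves the size of `S`. Two exits from `S` therefore force two entrances.
-/
theorem card_leaving_eq_card_entering (S : Set (ZMod N)) [DecidablePred (· ∈ S)] :
    (Finset.univ.filter fun a : ZMod N => a ∈ S ∧ a + 1 ∉ S).card =
      (Finset.univ.filter fun a : ZMod N => a ∉ S ∧ a + 1 ∈ S).card := by
  classical
  set U := Finset.univ.filter fun a : ZMod N => a ∈ S with hU
  set W := Finset.univ.filter fun a : ZMod N => a + 1 ∈ S with hW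
  have hUW : W.card = U.card := by
    refine Finset.card_bij (fun a _ => a + 1) ?_ ?_ ?_
    · intro a ha
      simpa [hU, hW] using ha
    · intro a _ b _ h
      exact add_right_cancel h
    · intro b hb
      exact ⟨b - 1, by simpa [hU, hW] using hb, by simp⟩
  have h := Finset.card_sdiff_comm hUW
  convert h.symm using 2
  · ext a; simp [hU, hW]
  · ext a; simp [hU, hW, and_comm]

/-- A set with two boundary points has more than `2m` crossing links. -/
theorem two_mul_lt_card_cut_circulantLinks (hm : 1 ≤ m) (hN : 2 * m + 1 ≤ N) (hN5 : 5 ≤ N)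
    {S : Set (ZMod N)} {x x' : ZMod N} (hne : x ≠ x') (hx : x ∈ S) (hx1 : x + 1 ∉ S)
    (hx' : x' ∈ S) (hx1' : x' + 1 ∉ S) :
    2 * m + 1 ≤ (cut (circulantLinks N m) S).card := by
  classical
  have hcard : 2 ≤ (Finset.univ.filter fun a : ZMod N => a ∉ S ∧ a + 1 ∈ S).card := by
    rw [← card_leaving_eq_card_entering]
    refine (Finset.card_pair hne).symm.le.trans (Finset.card_le_card fun a ha => ?_)
    rcases Finset.mem_insert.1 ha with rfl | ha
    · simp [hx, hx1]
    · rw [Finset.mem_singleton.1 ha]; simp [hx', hx1']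
  obtain ⟨y, hy, y', hy', hyne⟩ := Finset.one_lt_card.1 hcard
  simp only [Finset.mem_filter, Finset.mem_univ, true_and] at hy hy'
  -- an entering point that touches neither of the two ends of a leaving link
  have key : ∀ x x' y : ZMod N, x ≠ x' → x ∈ S → x + 1 ∉ S → x' ∈ S → x' + 1 ∉ S →
      y ∉ S → y + 1 ∈ S → y ≠ x + 1 → y + 1 ≠ x →
      2 * m + 1 ≤ (cut (circulantLinks N m) S).card := by
    intro x x' y hne hx hx1 hx' hx1' hy hy1 h1 h2
    obtain ⟨L, hL, hc, hinc⟩ := exists_boundary_links hm hN hx hx1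
    have step : ∀ a : ZMod N, s(a, a + 1) ∈ circulantLinks N m := fun a =>
      mem_circulantLinks.2 ⟨a, 1, le_rfl, hm, by simp⟩
    -- Besides the `2m - 1` links that touch `x` or `x + 1`, the unit steps at `x'` and at `y` cross
    -- the cut without touching these two points.
    have hsub : insert s(y, y + 1) (insert s(x', x' + 1) L) ⊆ cut (circulantLinks N m) S := by
      intro e he
      rcases Finset.mem_insert.1 he with rfl | he
      · exact mem_cut.2 ⟨step y, y + 1, hy1, y, hy, Sym2.eq_swap⟩
      · rcases Finset.mem_insert.1 he with rfl | he
        · exact mem_cut.2 ⟨step x', x', hx', x' + 1, hx1', rfl⟩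
        · exact hL he
    have n1 : s(x', x' + 1) ∉ L := by
      intro h
      have := hinc _ h
      simp only [Sym2.mem_iff] at this
      rcases this with (h | h) | (h | h)
      · exact hne h
      · exact hx1' (h ▸ hx)
      · exact hx1 (h ▸ hx')
      · exact hne (add_right_cancel h)
    have n2 : s(y, y + 1) ∉ insert s(x', x' + 1) L := by
      intro h
      rcases Finset.mem_insert.1 h with h | h
      · rcases Sym2.eq_iff.1 h with ⟨h, -⟩ | ⟨h, h'⟩
        · exact hy (h ▸ hx')
        · rw [h, add_assoc, add_eq_left] at h'
          refine natCast_zmod_ne_zero (N := N) (j := 2) (by omega) (by omega) ?_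
          push_cast
          linear_combination h'
      · have := hinc _ h
        simp only [Sym2.mem_iff] at this
        rcases this with (h | h) | (h | h)
        · exact hy (h ▸ hx)
        · exact h2 h.symm
        · exact h1 h.symm
        · exact hx1 (h ▸ hy1)
    have := Finset.card_le_card hsub
    rw [Finset.card_insert_of_notMem n2, Finset.card_insert_of_notMem n1] at this
    omega
  by_contra hcon
  have k1 : ∀ y, y ∉ S → y + 1 ∈ S → y = x + 1 ∨ y + 1 = x := fun y h h' => by
    by_contra hc
    rw [not_or] at hc
    exact hcon (key x x' y hne hx hx1 hx' hx1' h h' hc.1 hc.2)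
  have k2 : ∀ y, y ∉ S → y + 1 ∈ S → y = x' + 1 ∨ y + 1 = x' := fun y h h' => by
    by_contra hc
    rw [not_or] at hc
    exact hcon (key x' x y hne.symm hx' hx1' hx hx1 h h' hc.1 hc.2)
  -- If both entrances touch both exit links, the four unit steps close up to a cycle of length 4,
  -- which `5 ≤ N` excludes.
  have h4 : ((4 : ℕ) : ZMod N) ≠ 0 := natCast_zmod_ne_zero (by omega) (by omega)
  refine h4 ?_
  push_cast
  have a1 := k1 y hy.1 hy.2
  have a2 := k1 y' hy'.1 hy'.2
  have a3 := k2 y hy.1 hy.2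
  have a4 := k2 y' hy'.1 hy'.2
  rcases a1 with a1 | a1 <;> rcases a3 with a3 | a3
  · exact absurd (add_right_cancel (a1.symm.trans a3)) hne
  · rcases a2 with a2 | a2
    · exact absurd (a1.trans a2.symm) hyne
    · rcases a4 with a4 | a4
      · linear_combination a3 - a1 + a2 - a4
      · exact absurd (a2.symm.trans a4) hne
  · rcases a2 with a2 | a2
    · rcases a4 with a4 | a4
      · exact absurd (add_right_cancel (a2.symm.trans a4)) hne
      · linear_combination a1 - a3 + a4 - a2
    · exact absurd (add_right_cancel (a1.trans a2.symm)) hyne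
  · exact absurd (a1.symm.trans a3) hne

/-- The circulant graph together with an antipodal matching of `2h` points at distance at least
`m + 1`: a cut that separates two of these points has more than `2m` crossing links, unless one of
the pairs of the matching is separated. -/
theorem two_mul_lt_card_cut_of_matching {h : ℕ} (hm : 1 ≤ m) (hN : 2 * h * (m + 1) ≤ N)
    {S : Set (ZMod N)}
    (hS : ∀ i < h, ((i * (m + 1) : ℕ) : ZMod N) ∈ S ↔ (((i + h) * (m + 1) : ℕ) : ZMod N) ∈ S)
    {a b : ℕ} (ha : a < 2 * h) (hb : b < 2 * h) (haS : ((a * (m + 1) : ℕ) : ZMod N) ∈ S)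
    (hbS : ((b * (m + 1) : ℕ) : ZMod N) ∉ S) :
    2 * m + 1 ≤ (cut (circulantLinks N m) S).card := by
  have hpos : 1 ≤ h := by omega
  -- Antipodal marks agree, so the marks `0, …, h` determine all others; if they were all on one
  -- side, no two marks would be separated.
  have hne : ∃ i < h, ¬ (((i * (m + 1) : ℕ) : ZMod N) ∈ S ↔
      (((i + 1) * (m + 1) : ℕ) : ZMod N) ∈ S) := by
    by_contra hcon
    push Not at hcon
    have h1 : ∀ i ≤ h, (((i * (m + 1) : ℕ) : ZMod N) ∈ S ↔ ((0 : ℕ) : ZMod N) ∈ S) := by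
      intro i hi
      induction i with
      | zero => rw [Nat.zero_mul]
      | succ i ih => exact (hcon i (by omega)).symm.trans (ih (by omega))
    have h2 : ∀ i < 2 * h, (((i * (m + 1) : ℕ) : ZMod N) ∈ S ↔ ((0 : ℕ) : ZMod N) ∈ S) := by
      intro i hi
      by_cases hih : i < h
      · exact h1 i hih.le
      · have := hS (i - h) (by omega)
        rw [Nat.sub_add_cancel (by omega)] at this
        exact this.symm.trans (h1 _ (by omega))
    exact hbS ((h2 b hb).2 ((h2 a ha).1 haS))
  obtain ⟨i, hi, hii⟩ := hne
  have h2h : 2 ≤ h := by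
    by_contra hc
    have : h = 1 := by omega
    subst this
    have : i = 0 := by omega
    subst this
    exact hii (hS 0 (by omega))
  have hN2 : 2 * 2 * (m + 1) ≤ N := (Nat.mul_le_mul_right _ (by omega)).trans hN
  -- the far side of the second gap
  obtain ⟨q, hq1, hq2, hqS⟩ : ∃ q : ℕ, (i + h) * (m + 1) ≤ q ∧ q ≤ N ∧
      ((((i + 1) * (m + 1) : ℕ) : ZMod N) ∈ S ↔ (q : ZMod N) ∈ S) := by
    by_cases hih : i + 1 < h
    · refine ⟨(i + 1 + h) * (m + 1), Nat.mul_le_mul_right _ (by omega),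
        (Nat.mul_le_mul_right _ (by omega)).trans hN, hS _ hih⟩
    -- The antipode of the last gap wraps around: it ends at `N`, which is the mark `0`, the partner
    -- of the mark `h`.
    · refine ⟨N, (Nat.mul_le_mul_right _ (by omega)).trans hN, le_rfl, ?_⟩
      have := hS 0 hpos
      have hih' : i + 1 = h := by omega
      rw [Nat.zero_mul, Nat.zero_add] at this
      rw [hih', ZMod.natCast_self, ← this, Nat.cast_zero]
  have hiS := hS i hi
  have hlt : (i + 1) * (m + 1) ≤ (i + h) * (m + 1) := Nat.mul_le_mul_right _ (by omega)
  have hle : i * (m + 1) ≤ (i + 1) * (m + 1) := Nat.mul_le_mul_right _ (by omega)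
  -- The gap after mark `i` and its antipodal gap each contain an exit from `S'`, and these exits
  -- are distinct because the gaps do not overlap. If mark `i` is outside `S`, this is applied to
  -- the complement.
  have main : ∀ S' : Set (ZMod N), ((i * (m + 1) : ℕ) : ZMod N) ∈ S' →
      (((i + 1) * (m + 1) : ℕ) : ZMod N) ∉ S' → (((i + h) * (m + 1) : ℕ) : ZMod N) ∈ S' →
      (q : ZMod N) ∉ S' → 2 * m + 1 ≤ (cut (circulantLinks N m) S').card := by
    intro S' s1 s2 s3 s4
    obtain ⟨c, c1, c2, c3, c4⟩ := exists_boundary_between hle s1 s2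
    obtain ⟨c', c1', c2', c3', c4'⟩ := exists_boundary_between hq1 s3 s4
    refine two_mul_lt_card_cut_circulantLinks hm (by omega) (by omega) (x := c) (x' := c') ?_
      c3 c4 c3' c4'
    intro hcc
    have := natCast_zmod_inj (by omega) (by omega) hcc
    omega
  by_cases hc : ((i * (m + 1) : ℕ) : ZMod N) ∈ S
  · have : (((i + 1) * (m + 1) : ℕ) : ZMod N) ∉ S := by tauto
    exact main S hc this (hiS.1 hc) (by rwa [← hqS])
  · have : (((i + 1) * (m + 1) : ℕ) : ZMod N) ∈ S := by tauto
    rw [← cut_compl]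
    refine main Sᶜ hc (by simpa using this) (by rwa [Set.mem_compl_iff, ← hiS]) ?_
    simpa using hqS.1 this

end Circulant

/-! ### Cuts of unions and images; stars -/

theorem card_cut_le_card_cut {V : Type*} {E F : Finset (Sym2 V)} (h : E ⊆ F) (S : Set V) :
    (cut E S).card ≤ (cut F S).card :=
  Finset.card_le_card fun _ he => mem_cut.2 ⟨h (mem_cut.1 he).1, (mem_cut.1 he).2⟩

theorem card_cut_union {V : Type*} [DecidableEq V] {E F : Finset (Sym2 V)} (h : Disjoint E F)
    (S : Set V) : (cut (E ∪ F) S).card = (cut E S).card + (cut F S).card := by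
  classical
  rw [← Finset.card_union_of_disjoint]
  · congr 1
    ext e
    simp only [mem_cut, Finset.mem_union]
    tauto
  · exact Finset.disjoint_of_subset_left (Finset.filter_subset _ _)
      (Finset.disjoint_of_subset_right (Finset.filter_subset _ _) h)

theorem card_cut_image {V W : Type*} [DecidableEq W] {f : V → W} (hf : Function.Injective f)
    (E : Finset (Sym2 V)) (S : Set W) :
    (cut (E.image (Sym2.map f)) S).card = (cut E (f ⁻¹' S)).card := by
  classical
  rw [← Finset.card_image_of_injective _ (Sym2.map.injective hf)]
  congr 1
  ext e
  simp only [mem_cut, Finset.mem_image]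
  constructor
  · rintro ⟨⟨e, he, rfl⟩, h⟩
    exact ⟨e, ⟨he, (crosses_map f).1 h⟩, rfl⟩
  · rintro ⟨e, ⟨he, h⟩, rfl⟩
    exact ⟨⟨e, he, rfl⟩, (crosses_map f).2 h⟩

theorem not_isDiag_of_mem_image {V W : Type*} [DecidableEq W] {f : V → W}
    (hf : Function.Injective f) {E : Finset (Sym2 V)} (hE : ∀ e ∈ E, ¬ e.IsDiag) :
    ∀ e ∈ E.image (Sym2.map f), ¬ e.IsDiag := by
  intro e he
  obtain ⟨e, he', rfl⟩ := Finset.mem_image.1 he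
  rw [Sym2.isDiag_map hf]
  exact hE e he'

/-- The links from `c` to the nodes of `T`. -/
def starLinks {V : Type*} [DecidableEq V] (c : V) (T : Finset V) : Finset (Sym2 V) :=
  T.image fun v => s(c, v)

theorem card_starLinks {V : Type*} [DecidableEq V] (c : V) (T : Finset V) :
    (starLinks c T).card = T.card :=
  Finset.card_image_of_injective _ fun _ _ h => Sym2.congr_right.1 h

theorem exists_mem_starLinks_crosses {V : Type*} [DecidableEq V] {c : V} {T : Finset V}
    {S : Set V} {i j : V} (hi : i ∈ insert c T) (hj : j ∈ insert c T) (hiS : i ∈ S) (hjS : j ∉ S) :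
    ∃ e ∈ starLinks c T, Crosses S e := by
  by_cases hc : c ∈ S
  · have hjc : j ≠ c := fun h => hjS (h ▸ hc)
    exact ⟨s(c, j), Finset.mem_image_of_mem _ (Finset.mem_of_mem_insert_of_ne hj hjc),
      c, hc, j, hjS, rfl⟩
  · have hic : i ≠ c := fun h => hc (h ▸ hiS)
    exact ⟨s(c, i), Finset.mem_image_of_mem _ (Finset.mem_of_mem_insert_of_ne hi hic),
      i, hiS, c, hc, Sym2.eq_swap⟩

theorem not_isDiag_of_mem_starLinks {V : Type*} [DecidableEq V] {c : V} {T : Finset V}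
    (hc : c ∉ T) : ∀ e ∈ starLinks c T, ¬ e.IsDiag := by
  intro e he
  obtain ⟨v, hv, rfl⟩ := Finset.mem_image.1 he
  rw [Sym2.mk_isDiag_iff]
  rintro rfl
  exact hc hv

/-! ### Optimal candidates with protected stars -/

namespace TwoLayerNetwork

/-- A network whose protected links form a spanning star. -/
theorem exists_resistant_spanning_star {n₁ n₂ : ℕ} (k₁ k₂ : ℕ) (hn₂ : 1 ≤ n₂) :
    ∃ s : TwoLayerNetwork n₁ n₂, s.Resistant k₁ k₂ ∧ s.prot.card = n₁ + n₂ - 1 ∧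
      s.nonprot.card = 0 := by
  set c : Device n₁ n₂ := Sum.inr ⟨0, hn₂⟩
  refine ⟨⟨starLinks c (Finset.univ.erase c), ∅,
    not_isDiag_of_mem_starLinks (Finset.notMem_erase _ _), by simp, by simp⟩, ⟨?_, ?_⟩, ?_, ?_⟩
  · intro A _ hA i j
    exact reachable_of_cut (k := k₁) _ (fun S hi hj => Or.inl
      (exists_mem_starLinks_crosses (by simp) (by simp) hi hj)) A hA
  · intro A _ hA i j
    exact reachable_of_cut (k := k₂) _ (fun S hi hj => Or.inl
      (exists_mem_starLinks_crosses (by simp) (by simp) hi hj)) A hA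
  · simp [card_starLinks, Finset.card_erase_of_mem]
  · rfl

/-- A network whose protected links form a star on the devices of type 2, and whose non-protected
links form a circulant graph on the devices of type 1 and the centre of the star. -/
theorem exists_resistant_star {n₁ n₂ m : ℕ} (k₂ : ℕ) (hn₂ : 1 ≤ n₂) (hm : 1 ≤ m)
    (hn₁ : 2 * m ≤ n₁) :
    ∃ s : TwoLayerNetwork n₁ n₂, s.Resistant (2 * m - 1) k₂ ∧ s.prot.card = n₂ - 1 ∧
      s.nonprot.card ≤ (n₁ + 1) * m := by
  set o : Fin n₂ := ⟨0, hn₂⟩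
  set T : Finset (Device n₁ n₂) := (Finset.univ.erase o).image Sum.inr with hT
  have hTo : Sum.inr o ∉ T := by simp [hT]
  have hTr : ∀ j : Fin n₂, (Sum.inr j : Device n₁ n₂) ∈ insert (Sum.inr o) T := by
    intro j
    by_cases h : j = o <;> simp [hT, h]
  -- The `n₁ + 1` points of the circle are the devices of type 1 and, as `none`, the centre of the
  -- star.
  obtain ⟨φ⟩ : Nonempty (ZMod (n₁ + 1) ≃ Option (Fin n₁)) :=
    ⟨Fintype.equivOfCardEq (by simp [ZMod.card])⟩
  set f : ZMod (n₁ + 1) → Device n₁ n₂ := fun z => (φ z).elim (Sum.inr o) Sum.inl with hf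
  have hf0 : f (φ.symm none) = Sum.inr o := by simp [hf]
  have hf1 : ∀ i, f (φ.symm (some i)) = Sum.inl i := by simp [hf]
  have hfinj : Function.Injective f := by
    intro z w h
    apply φ.injective
    simp only [hf] at h
    revert h
    cases φ z <;> cases φ w <;> simp
  have hfT : ∀ z, f z ∉ T := by
    intro z
    simp only [hf]
    cases φ z
    · exact hTo
    · simp [hT]
  have hN : 2 * m + 1 ≤ n₁ + 1 := by omega
  have hcut : ∀ S : Set (Device n₁ n₂), ∀ i j, i ∈ S → j ∉ S →
      (∃ e ∈ starLinks (Sum.inr o) T, Crosses S e) ∨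
        2 * m ≤ (cut ((circulantLinks (n₁ + 1) m).image (Sym2.map f)) S).card := by
    intro S i j hi hj
    by_contra hcon
    rw [not_or] at hcon
    -- If no protected link crosses `S`, all of type 2 lies on the side of the centre, and `S` still
    -- induces a proper cut of the circulant graph.
    have hV₂ : ∀ a : Fin n₂, Sum.inr a ∈ S ↔ Sum.inr o ∈ S := by
      intro a
      by_contra hne
      apply hcon.1
      by_cases ha : Sum.inr a ∈ S
      · exact exists_mem_starLinks_crosses (hTr a) (hTr o) ha (by tauto)
      · exact exists_mem_starLinks_crosses (hTr o) (hTr a) (by tauto) ha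
    have hpre : ∀ v : Device n₁ n₂, ∃ z, v ∈ S ↔ z ∈ f ⁻¹' S := by
      rintro (a | a)
      · exact ⟨φ.symm (some a), by rw [Set.mem_preimage, hf1]⟩
      · exact ⟨φ.symm none, by rw [Set.mem_preimage, hf0, hV₂]⟩
    obtain ⟨a, ha⟩ := hpre i
    obtain ⟨b, hb⟩ := hpre j
    refine hcon.2 ?_
    rw [card_cut_image hfinj]
    exact two_mul_le_card_cut_circulantLinks hN (ha.1 hi) (fun h => hj (hb.2 h))
  refine ⟨⟨starLinks (Sum.inr o) T, (circulantLinks (n₁ + 1) m).image (Sym2.map f),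
    not_isDiag_of_mem_starLinks hTo, not_isDiag_of_mem_image hfinj fun e he =>
      not_isDiag_of_mem_circulantLinks (by omega) he, ?_⟩, ⟨?_, ?_⟩, ?_, ?_⟩
  · rw [Finset.disjoint_left]
    intro e he he'
    obtain ⟨v, hv, rfl⟩ := Finset.mem_image.1 he
    obtain ⟨e, -, h⟩ := Finset.mem_image.1 he'
    have h1 : v ∈ Sym2.map f e := h ▸ Sym2.mem_mk_right _ _
    obtain ⟨z, -, rfl⟩ := Sym2.mem_map.1 h1
    exact hfT z hv
  · intro A _ hA i j
    refine reachable_of_cut (k := 2 * m - 1) _ (fun S hi hj => ?_) A hA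
    rw [Nat.sub_add_cancel (by omega)]
    exact hcut S i j hi hj
  · intro A _ hA i j
    exact reachable_of_cut (k := k₂) _ (fun S hi hj => Or.inl
      (exists_mem_starLinks_crosses (hTr i) (hTr j) hi hj)) A hA
  · rw [card_starLinks, hT, Finset.card_image_of_injective _ Sum.inr_injective,
      Finset.card_erase_of_mem (Finset.mem_univ _), Finset.card_univ, Fintype.card_fin]
  · exact Finset.card_image_le.trans card_circulantLinks_le

end TwoLayerNetwork

/-! ### The candidate without protected links -/

/-- There is a graph on `ℤ/N` with `N d / 2` links and all cuts of size at least `d`, up to one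
link for the cuts that do not separate any antipodal pair. -/
theorem exists_links_antipodal {N d : ℕ} [NeZero N] (hN : d + 1 ≤ N) (heven : Even (N * d)) :
    ∃ Q : Finset (Sym2 (ZMod N)), (∀ e ∈ Q, ¬ e.IsDiag) ∧ 2 * Q.card ≤ N * d ∧
      ∀ (T : Set (ZMod N)) (a b : ZMod N), a ∈ T → b ∉ T →
        d ≤ (cut Q T).card ∨ (d ≤ (cut Q T).card + 1 ∧ ∃ h : ℕ, N = 2 * h ∧
          ∀ i < h, ((i : ℕ) : ZMod N) ∈ T ↔ ((i + h : ℕ) : ZMod N) ∈ T) := by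
  classical
  obtain ⟨r, rfl | rfl⟩ := Nat.even_or_odd' d
  · refine ⟨circulantLinks N r, fun e he => not_isDiag_of_mem_circulantLinks (by omega) he, ?_, ?_⟩
    · have := card_circulantLinks_le (N := N) (m := r)
      nlinarith
    · intro T a b ha hb
      exact Or.inl (two_mul_le_card_cut_circulantLinks (by omega) ha hb)
  -- For `d = 2r + 1` the circulant graph contributes `2r` to a proper cut, and the matching of `i`
  -- with `i + h` at least one more if it splits a pair. The matching is new because `h > r`.
  · obtain ⟨h, hh⟩ : Even N := by
      rcases Nat.even_mul.1 heven with h | h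
      · exact h
      · exact absurd h (by simp)
    set M : Finset (Sym2 (ZMod N)) :=
      (Finset.range h).image fun i : ℕ => s((i : ZMod N), ((i + h : ℕ) : ZMod N)) with hM
    have hMc : M.card ≤ h := Finset.card_image_le.trans (by simp)
    have hdisj : Disjoint (circulantLinks N r) M := by
      rw [Finset.disjoint_left]
      intro e he he'
      obtain ⟨i, hi, rfl⟩ := Finset.mem_image.1 he'
      obtain ⟨a, j, h1, h2, h3⟩ := mem_circulantLinks.1 he
      rcases Sym2.eq_iff.1 h3 with ⟨rfl, h5⟩ | ⟨h4, h5⟩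
      · push_cast at h5
        have := natCast_zmod_inj (by omega) (by omega) (add_left_cancel h5)
        omega
      · refine natCast_zmod_ne_zero (N := N) (j := h + j) (by omega) (by omega) ?_
        rw [← h5] at h4
        push_cast at h4 ⊢
        linear_combination -h4
    refine ⟨circulantLinks N r ∪ M, ?_, ?_, ?_⟩
    · intro e he
      rcases Finset.mem_union.1 he with he | he
      · exact not_isDiag_of_mem_circulantLinks (by omega) he
      · obtain ⟨i, hi, rfl⟩ := Finset.mem_image.1 he
        rw [Sym2.mk_isDiag_iff]
        intro h1
        push_cast at h1
        exact natCast_zmod_ne_zero (by omega) (by omega) (left_eq_add.1 h1)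
    · have h1 := card_circulantLinks_le (N := N) (m := r)
      have h2 := Finset.card_union_le (circulantLinks N r) M
      have h3 : N * (2 * r + 1) = 2 * (N * r) + N := by ring
      omega
    · intro T a b ha hb
      have h1 := two_mul_le_card_cut_circulantLinks (m := r) (by omega) ha hb
      rw [card_cut_union hdisj]
      by_cases hc : ∀ i < h, ((i : ℕ) : ZMod N) ∈ T ↔ ((i + h : ℕ) : ZMod N) ∈ T
      · exact Or.inr ⟨by omega, h, by omega, hc⟩
      · push Not at hc
        obtain ⟨i, hi, hc⟩ := hc
        have : 1 ≤ (cut M T).card := by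
          refine Finset.card_pos.2 ⟨s((i : ZMod N), ((i + h : ℕ) : ZMod N)), mem_cut.2
            ⟨Finset.mem_image_of_mem _ (Finset.mem_range.2 hi), crosses_mk.2 ?_⟩⟩
          tauto
        exact Or.inl (by omega)

/-- Distinct multiples of `m + 1` are more than `m` apart, also across the wrap-around, as `n * (m +
1) ≤ N`. Hence links between type 2 devices at such places never repeat a circulant link. -/
theorem notMem_circulantLinks_of_mul {N m n i j : ℕ} [NeZero N] (hN : n * (m + 1) ≤ N)
    (hi : i < n) (hj : j < n) :
    s(((i * (m + 1) : ℕ) : ZMod N), ((j * (m + 1) : ℕ) : ZMod N)) ∉ circulantLinks N m := by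
  have key : ∀ i j t : ℕ, i < n → j < n → 1 ≤ t → t ≤ m →
      ((j * (m + 1) : ℕ) : ZMod N) ≠ ((i * (m + 1) : ℕ) : ZMod N) + (t : ZMod N) := by
    intro i j t hi hj h1 h2 h3
    have hi' : (i + 1) * (m + 1) ≤ n * (m + 1) := Nat.mul_le_mul_right _ hi
    have hj' : (j + 1) * (m + 1) ≤ n * (m + 1) := Nat.mul_le_mul_right _ hj
    rw [Nat.add_mul, Nat.one_mul] at hi' hj'
    rw [← Nat.cast_add] at h3
    have h4 := natCast_zmod_inj (by omega) (by omega) h3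
    have h5 : (m + 1) ∣ t := (Nat.dvd_add_right (Dvd.intro_left i rfl)).1 (h4 ▸ Dvd.intro_left j rfl)
    exact absurd (Nat.le_of_dvd h1 h5) (by omega)
  intro h
  obtain ⟨a, t, h1, h2, h3⟩ := mem_circulantLinks.1 h
  rcases Sym2.eq_iff.1 h3 with ⟨rfl, h5⟩ | ⟨h4, rfl⟩
  · exact key i j t hi hj h1 h2 h5
  · exact key j i t hj hi h1 h2 h4

/-- Devices of type 2 can be put at prescribed places, those of type 1 filling the rest in any
order. -/
theorem exists_equiv_extending {n₁ n₂ : ℕ} {α : Type*} [Fintype α] [DecidableEq α]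
    (hα : Fintype.card α = n₁ + n₂) {g : Fin n₂ → α} (hg : Function.Injective g) :
    ∃ ψ : Device n₁ n₂ ≃ α, ∀ j, ψ (Sum.inr j) = g j := by
  have hc : Fintype.card (Fin n₁) = Fintype.card {a // a ∉ Set.range g} := by
    have h1 := Fintype.card_subtype_compl (· ∈ Set.range g)
    have h2 : Fintype.card {a // a ∈ Set.range g} = n₂ := by
      rw [← Fintype.card_congr (Equiv.ofInjective g hg), Fintype.card_fin]
    rw [Fintype.card_fin, h1, h2, hα]
    omega
  let e₁ := Fintype.equivOfCardEq hc
  refine ⟨((Equiv.sumCongr e₁ (Equiv.ofInjective g hg)).trans (Equiv.sumComm _ _)).trans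
    (Equiv.sumCompl (· ∈ Set.range g)), fun j => ?_⟩
  simp

namespace TwoLayerNetwork

/-- A network without protected links: a circulant graph in which any two devices of type 2 are
more than `m` steps apart, together with links between devices of type 2. -/
theorem exists_resistant_unprotected {n₁ n₂ m d : ℕ} (hm : 1 ≤ m) (hn₂ : d + 1 ≤ n₂)
    (hn₁ : 2 * m ≤ n₁) (hn : n₂ * m ≤ n₁) (heven : Even (n₂ * d)) :
    ∃ s : TwoLayerNetwork n₁ n₂, s.Resistant (2 * m - 1) (2 * m - 1 + d) ∧ s.prot.card = 0 ∧
      2 * s.nonprot.card ≤ n₁ * (2 * m) + n₂ * (2 * m + d) := by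
  classical
  have : NeZero n₂ := ⟨by omega⟩
  have : NeZero (n₁ + n₂) := ⟨by omega⟩
  have hN : n₂ * (m + 1) ≤ n₁ + n₂ := by rw [Nat.mul_add]; omega
  have hN' : 2 * m + 1 ≤ n₁ + n₂ := by omega
  have hlt : ∀ j : Fin n₂, (j : ℕ) * (m + 1) < n₁ + n₂ := fun j =>
    (Nat.mul_lt_mul_of_pos_right j.2 (by omega)).trans_le hN
  obtain ⟨ψ, hψ⟩ := exists_equiv_extending (n₁ := n₁) (n₂ := n₂) (α := ZMod (n₁ + n₂))
    (ZMod.card _) (g := fun j => (((j : ℕ) * (m + 1) : ℕ) : ZMod (n₁ + n₂))) (by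
      intro i j h
      exact Fin.ext (Nat.eq_of_mul_eq_mul_right (by omega) (natCast_zmod_inj (hlt i) (hlt j) h)))
  obtain ⟨Q, hQ1, hQ2, hQ3⟩ := exists_links_antipodal hn₂ heven
  set f : ZMod n₂ → Device n₁ n₂ := fun z => Sum.inr ⟨z.val, ZMod.val_lt z⟩ with hf
  have hfinj : Function.Injective f := fun z w h => by
    simp only [hf, Sum.inr.injEq, Fin.mk.injEq] at h
    exact ZMod.val_injective _ h
  have hfcast : ∀ j : Fin n₂, f ((j : ℕ) : ZMod n₂) = Sum.inr j := fun j => by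
    simp only [hf, ZMod.val_natCast_of_lt j.2]
  set C : Finset (Sym2 (Device n₁ n₂)) :=
    (circulantLinks (n₁ + n₂) m).image (Sym2.map ψ.symm) with hC
  set D : Finset (Sym2 (Device n₁ n₂)) := Q.image (Sym2.map f) with hD
  have hdisj : Disjoint C D := by
    rw [Finset.disjoint_left]
    intro e he he'
    obtain ⟨e', h1, h2⟩ := Finset.mem_image.1 he
    obtain ⟨q, hq, rfl⟩ := Finset.mem_image.1 he'
    induction q using Sym2.ind with
    | _ a b =>
      have h3 : e' = s(ψ (f a), ψ (f b)) := by
        have := congrArg (Sym2.map ψ) h2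
        simpa [Sym2.map_map] using this
      rw [h3] at h1
      simp only [hf, hψ] at h1
      exact notMem_circulantLinks_of_mul hN (ZMod.val_lt a) (ZMod.val_lt b) h1
  have hcutC : ∀ S i j, i ∈ S → j ∉ S → 2 * m ≤ (cut C S).card := by
    intro S i j hi hj
    rw [hC, card_cut_image ψ.symm.injective]
    exact two_mul_le_card_cut_circulantLinks hN' (a := ψ i) (b := ψ j) (by simpa) (by simpa)
  refine ⟨⟨∅, C ∪ D, by simp, ?_, by simp⟩, ⟨?_, ?_⟩, rfl, ?_⟩
  · intro e he
    rcases Finset.mem_union.1 he with he | he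
    · exact not_isDiag_of_mem_image ψ.symm.injective
        (fun e he => not_isDiag_of_mem_circulantLinks (by omega) he) e he
    · exact not_isDiag_of_mem_image hfinj hQ1 e he
  · intro A _ hA i j
    refine reachable_of_cut (k := 2 * m - 1) _ (fun S hi hj => Or.inr ?_) A hA
    have h1 := hcutC S i j hi hj
    have h2 := card_cut_le_card_cut (Finset.subset_union_left : C ⊆ C ∪ D) S
    simp only
    omega
  · intro A _ hA i j
    refine reachable_of_cut (k := 2 * m - 1 + d) _ (fun S hi hj => Or.inr ?_) A hA
    have h1 := hcutC S _ _ hi hj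
    simp only
    rw [card_cut_union hdisj, hD, card_cut_image hfinj]
    rcases hQ3 (f ⁻¹' S) (i : ℕ) (j : ℕ) (by rwa [Set.mem_preimage, hfcast])
      (by rwa [Set.mem_preimage, hfcast]) with h2 | ⟨h2, h, hh, h3⟩
    · omega
    · have hpos : ∀ a : ℕ, a < n₂ → (((a * (m + 1) : ℕ) : ZMod (n₁ + n₂)) ∈ ψ.symm ⁻¹' S ↔
          ((a : ℕ) : ZMod n₂) ∈ f ⁻¹' S) := by
        intro a ha
        have e1 := hψ ⟨a, ha⟩
        have e2 := hfcast ⟨a, ha⟩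
        simp only at e1 e2
        rw [Set.mem_preimage, Set.mem_preimage, e2, ← e1, Equiv.symm_apply_apply]
      -- The links inside type 2 are one short of `d` here, and no antipodal pair is split, so the
      -- circulant graph makes up the difference.
      have h4 : 2 * m + 1 ≤ (cut C S).card := by
        rw [hC, card_cut_image ψ.symm.injective]
        refine two_mul_lt_card_cut_of_matching (h := h) hm (by rwa [← hh]) ?_
          (a := i) (b := j) (by omega) (by omega) ?_ ?_
        · intro a ha
          rw [hpos a (by omega), hpos (a + h) (by omega)]
          exact h3 a ha
        · rw [hpos _ i.2, Set.mem_preimage, hfcast]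
          exact hi
        · rw [hpos _ j.2, Set.mem_preimage, hfcast]
          exact hj
      omega
  · have h1 : C.card ≤ (n₁ + n₂) * m := Finset.card_image_le.trans card_circulantLinks_le
    have h2 : D.card ≤ Q.card := Finset.card_image_le
    have h3 := Finset.card_union_le C D
    simp only
    nlinarith

end TwoLayerNetwork

/-! ### Comparison of costs -/

namespace TwoLayerNetwork

variable {n₁ n₂ k₁ k₂ : ℕ} {cP cNP r A : ℝ}

/-- Twice the cost in units of the cost of a non-protected link; `r` stands for `2 cP / cNP`. -/
noncomputable def scaledCost (r : ℝ) (s : TwoLayerNetwork n₁ n₂) : ℝ :=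
  r * (s.prot.card : ℝ) + 2 * (s.nonprot.card : ℝ)

theorem cost_le_cost_iff (hcNP : 0 < cNP) (s t : TwoLayerNetwork n₁ n₂) :
    s.cost cP cNP ≤ t.cost cP cNP ↔
      s.scaledCost (2 * (cP / cNP)) ≤ t.scaledCost (2 * (cP / cNP)) := by
  have h : ∀ u : TwoLayerNetwork n₁ n₂,
      u.cost cP cNP = cNP / 2 * u.scaledCost (2 * (cP / cNP)) := by
    intro u
    rw [cost, scaledCost]
    field_simp
  rw [h, h, mul_le_mul_iff_right₀ (by positivity)]

theorem IsOptimal.isSD (hcNP : 0 < cNP) {s : TwoLayerNetwork n₁ n₂}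
    (hs : s.IsOptimal k₁ k₂ cP cNP) : s.IsSD k₁ k₂ s.prot.card := by
  refine ⟨hs.1, rfl, fun t ht hp => ?_⟩
  have h := (cost_le_cost_iff hcNP s t).1 (hs.2 t ht)
  rw [scaledCost, scaledCost, hp] at h
  have h' : (s.nonprot.card : ℝ) ≤ t.nonprot.card := by linarith
  exact_mod_cast h'

theorem IsOptimal.scaledCost_le (hcNP : 0 < cNP) {s t : TwoLayerNetwork n₁ n₂}
    (hs : s.IsOptimal k₁ k₂ cP cNP) (ht : t.Resistant k₁ k₂) :
    s.scaledCost (2 * (cP / cNP)) ≤ t.scaledCost (2 * (cP / cNP)) :=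
  (cost_le_cost_iff hcNP s t).1 (hs.2 t ht)

/-- A network with `p` protected links that attains a universal bound `A` is optimal, and any
`s^D_p` costs no more than it does. -/
theorem sdOptimal_of_lower_bound {p : ℕ} (hcNP : 0 < cNP)
    (hex : ∃ s : TwoLayerNetwork n₁ n₂, s.Resistant k₁ k₂ ∧ s.prot.card = p ∧
      s.scaledCost (2 * (cP / cNP)) ≤ A)
    (hlb : ∀ t : TwoLayerNetwork n₁ n₂, t.Resistant k₁ k₂ →
      A ≤ t.scaledCost (2 * (cP / cNP))) :
    SDOptimal n₁ n₂ k₁ k₂ cP cNP p := by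
  obtain ⟨s, hs, hp, hA⟩ := hex
  have hopt : s.IsOptimal k₁ k₂ cP cNP :=
    ⟨hs, fun t ht => (cost_le_cost_iff hcNP s t).2 (hA.trans (hlb t ht))⟩
  refine ⟨⟨s, hp ▸ hopt.isSD hcNP⟩, fun t ht => ⟨ht.1, fun u hu => ?_⟩⟩
  refine (cost_le_cost_iff hcNP t u).2 (le_trans ?_ (hA.trans (hlb u hu)))
  have h : (t.nonprot.card : ℝ) ≤ s.nonprot.card := by exact_mod_cast ht.2.2 s hs hp
  rw [scaledCost, scaledCost, ht.2.1, hp]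
  linarith

/-- An optimal network cannot exceed an attained value `A`, so it has `p` protected links; given
`p`, optimality minimizes the non-protected ones. -/
theorem onlySDOptimal_of_lower_bound {p : ℕ} (hcNP : 0 < cNP)
    (hex : ∃ s : TwoLayerNetwork n₁ n₂, s.Resistant k₁ k₂ ∧ s.scaledCost (2 * (cP / cNP)) ≤ A)
    (hlb : ∀ t : TwoLayerNetwork n₁ n₂, t.Resistant k₁ k₂ →
      t.prot.card = p ∨ A < t.scaledCost (2 * (cP / cNP))) :
    OnlySDOptimal n₁ n₂ k₁ k₂ cP cNP p := by
  intro t ht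
  obtain ⟨s, hs, hA⟩ := hex
  rcases hlb t ht.1 with h | h
  · exact h ▸ ht.isSD hcNP
  · exact absurd (ht.scaledCost_le hcNP hs) (by linarith)

/-- The lower bound for the cost when the two levels of resistance differ. -/
theorem Resistant.scaledCost_lower_bound (hn₂ : 1 ≤ n₂) (hk : k₁ < k₂) (hr : 0 < r)
    {s : TwoLayerNetwork n₁ n₂} (hs : s.Resistant k₁ k₂) :
    (s.prot.card = 0 ∧ (n₁ : ℝ) * (k₁ + 1) + n₂ * (k₂ + 1) ≤ s.scaledCost r) ∨
    (s.prot.card = n₂ - 1 ∧ r * ((n₂ : ℝ) - 1) + ((n₁ : ℝ) + 1) * (k₁ + 1) ≤ s.scaledCost r) ∨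
    (s.prot.card = n₁ + n₂ - 1 ∧ r * ((n₁ : ℝ) + n₂ - 1) ≤ s.scaledCost r) ∨
    (n₁ : ℝ) * (k₁ + 1) + n₂ * (k₂ + 1) < s.scaledCost r ∨
    r * ((n₂ : ℝ) - 1) + ((n₁ : ℝ) + 1) * (k₁ + 1) < s.scaledCost r ∨
    r * ((n₁ : ℝ) + n₂ - 1) < s.scaledCost r := by
  obtain ⟨c₁, c₂, h1, h2, h3, h4, h5, h6⟩ := hs.exists_contraction_bound hn₂
  rw [scaledCost]
  generalize s.prot.card = p at *
  generalize s.nonprot.card = q at *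
  have e1 : (c₁ : ℝ) ≤ n₁ := by exact_mod_cast h1
  have e2 : (1 : ℝ) ≤ c₂ := by exact_mod_cast h2
  have e3 : (c₂ : ℝ) ≤ n₂ := by exact_mod_cast h3
  have e4 : (n₁ : ℝ) + n₂ ≤ p + (c₁ + c₂) := by exact_mod_cast h4
  have ek : (k₁ : ℝ) + 1 ≤ k₂ := by exact_mod_cast hk
  have ec : (0 : ℝ) ≤ c₁ := Nat.cast_nonneg _
  have eq : (0 : ℝ) ≤ q := Nat.cast_nonneg _
  have ek0 : (0 : ℝ) ≤ k₁ := Nat.cast_nonneg _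
  have erp := mul_le_mul_of_nonneg_left e4 hr.le
  rcases Nat.lt_or_ge c₂ 2 with hc | hc
  · have hc2 : c₂ = 1 := by omega
    subst hc2
    rcases Nat.eq_zero_or_pos c₁ with h0 | h0
    · subst h0
      have hrp : r * ((n₁ : ℝ) + n₂ - 1) ≤ r * p := by push_cast at erp; linarith
      by_cases hp : p = n₁ + n₂ - 1
      · exact Or.inr (Or.inr (Or.inl ⟨hp, by linarith⟩))
      · have : (n₁ : ℝ) + n₂ < p + 1 := by exact_mod_cast (by omega : n₁ + n₂ < p + 1)
        have := mul_lt_mul_of_pos_left this hr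
        refine Or.inr (Or.inr (Or.inr (Or.inr (Or.inr ?_))))
        linarith
    · have h7 : ((c₁ : ℝ) + 1) * (k₁ + 1) ≤ 2 * q := by exact_mod_cast h6 rfl h0
      have e5 : (1 : ℝ) ≤ c₁ := by exact_mod_cast h0
      push_cast at erp
      -- The sign of `k₁ + 1 - r` decides whether the bound is least at `c₁ = 0` or at `c₁ = n₁`.
      rcases le_or_gt r ((k₁ : ℝ) + 1) with hrk | hrk
      · have := mul_le_mul_of_nonneg_left hrk (by linarith : 0 ≤ (c₁ : ℝ) + 1)
        refine Or.inr (Or.inr (Or.inr (Or.inr (Or.inr ?_))))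
        linarith
      · rcases Nat.lt_or_ge c₁ n₁ with hlt | hge
        · have e6 : (c₁ : ℝ) < n₁ := by exact_mod_cast hlt
          have := mul_pos (sub_pos.2 hrk) (sub_pos.2 e6)
          refine Or.inr (Or.inr (Or.inr (Or.inr (Or.inl ?_))))
          linarith
        · have : c₁ = n₁ := by omega
          subst this
          by_cases hp : p = n₂ - 1
          · exact Or.inr (Or.inl ⟨hp, by linarith⟩)
          · have : (n₂ : ℝ) < p + 1 := by exact_mod_cast (by omega : n₂ < p + 1)
            have := mul_lt_mul_of_pos_left this hr
            refine Or.inr (Or.inr (Or.inr (Or.inr (Or.inl ?_))))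
            linarith
  · have h7 : (c₁ : ℝ) * (k₁ + 1) + c₂ * (k₂ + 1) ≤ 2 * q := by exact_mod_cast h5 hc
    rcases Nat.eq_zero_or_pos p with hp | hp
    · subst hp
      have i1 : c₁ = n₁ := by omega
      have i2 : c₂ = n₂ := by omega
      subst i1 i2
      refine Or.inl ⟨rfl, ?_⟩
      push_cast
      linarith
    · have epos : (0 : ℝ) < p := by exact_mod_cast hp
      -- For `r ≤ k₂ + 1` the bound is least at `c₂ = 1`. The inequality is strict there because
      -- this bound counts `k₂ + 1` even for a single type 2 class. For larger `r` the least value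
      -- is at `(n₁, n₂)`, and `p > 0` makes it strict.
      rcases le_or_gt r ((k₂ : ℝ) + 1) with hrk | hrk
      · have m1 := mul_nonneg (sub_nonneg.2 hrk) (sub_nonneg.2 e2)
        rcases le_or_gt r ((k₁ : ℝ) + 1) with hrk' | hrk'
        · have m2 := mul_nonneg (sub_nonneg.2 hrk') ec
          refine Or.inr (Or.inr (Or.inr (Or.inr (Or.inr ?_))))
          linarith
        · have m2 := mul_nonneg (sub_nonneg.2 hrk'.le) (sub_nonneg.2 e1)
          refine Or.inr (Or.inr (Or.inr (Or.inr (Or.inl ?_))))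
          linarith
      · refine Or.inr (Or.inr (Or.inr (Or.inl ?_)))
        by_cases hcc : n₁ + n₂ ≤ c₁ + c₂
        · have i1 : c₁ = n₁ := by omega
          have i2 : c₂ = n₂ := by omega
          subst i1 i2
          have := mul_pos hr epos
          linarith
        · have e7 : (c₁ : ℝ) + c₂ < n₁ + n₂ := by exact_mod_cast (by omega : c₁ + c₂ < n₁ + n₂)
          have m1 := mul_pos (sub_pos.2 hrk) (sub_pos.2 e7)
          have m2 := mul_nonneg (by linarith : (0 : ℝ) ≤ (k₂ : ℝ) - k₁) (sub_nonneg.2 e1)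
          linarith

/-- The lower bound for the cost when the two levels of resistance coincide. -/
theorem Resistant.scaledCost_lower_bound_of_eq (hn₂ : 1 ≤ n₂) (hr : 0 < r)
    {s : TwoLayerNetwork n₁ n₂} (hs : s.Resistant k₁ k₁) :
    (s.prot.card = 0 ∧ ((n₁ : ℝ) + n₂) * (k₁ + 1) ≤ s.scaledCost r) ∨
    (s.prot.card = n₁ + n₂ - 1 ∧ r * ((n₁ : ℝ) + n₂ - 1) ≤ s.scaledCost r) ∨
    ((n₁ : ℝ) + n₂) * (k₁ + 1) < s.scaledCost r ∨
    r * ((n₁ : ℝ) + n₂ - 1) < s.scaledCost r := by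
  obtain ⟨c₁, c₂, h1, h2, h3, h4, h5, h6⟩ := hs.exists_contraction_bound hn₂
  rw [scaledCost]
  generalize s.prot.card = p at *
  generalize s.nonprot.card = q at *
  -- With equal levels only the total number of classes matters.
  have h56 : 2 ≤ c₁ + c₂ → (c₁ + c₂) * (k₁ + 1) ≤ 2 * q := by
    intro h
    rcases Nat.lt_or_ge c₂ 2 with hc | hc
    · have : c₂ = 1 := by omega
      subst this
      exact h6 rfl (by omega)
    · rw [Nat.add_mul]
      exact h5 hc
  obtain ⟨c, hc⟩ : ∃ c, c = c₁ + c₂ := ⟨_, rfl⟩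
  rw [← hc] at h4 h56
  have hc1 : 1 ≤ c := by omega
  have hcn : c ≤ n₁ + n₂ := by omega
  have e4 : (n₁ : ℝ) + n₂ ≤ p + c := by exact_mod_cast h4
  have ek0 : (0 : ℝ) ≤ k₁ := Nat.cast_nonneg _
  have eq : (0 : ℝ) ≤ q := Nat.cast_nonneg _
  have erp := mul_le_mul_of_nonneg_left e4 hr.le
  rcases Nat.lt_or_ge c 2 with hc2 | hc2
  · have : c = 1 := by omega
    subst this
    push_cast at erp
    by_cases hp : p = n₁ + n₂ - 1
    · exact Or.inr (Or.inl ⟨hp, by linarith⟩)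
    · have : (n₁ : ℝ) + n₂ < p + 1 := by exact_mod_cast (by omega : n₁ + n₂ < p + 1)
      have := mul_lt_mul_of_pos_left this hr
      refine Or.inr (Or.inr (Or.inr ?_))
      linarith
  · have h7 : (c : ℝ) * (k₁ + 1) ≤ 2 * q := by exact_mod_cast h56 hc2
    rcases Nat.eq_zero_or_pos p with hp | hp
    · subst hp
      refine Or.inl ⟨rfl, ?_⟩
      have : c = n₁ + n₂ := by omega
      subst this
      push_cast at h7 ⊢
      linarith
    · have epos : (0 : ℝ) < p := by exact_mod_cast hp
      rcases le_or_gt r ((k₁ : ℝ) + 1) with hrk | hrk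
      · have := mul_le_mul_of_nonneg_left hrk (Nat.cast_nonneg c)
        refine Or.inr (Or.inr (Or.inr ?_))
        linarith
      · refine Or.inr (Or.inr (Or.inl ?_))
        rcases Nat.lt_or_ge c (n₁ + n₂) with hlt | hge
        · have e6 : (c : ℝ) < n₁ + n₂ := by exact_mod_cast hlt
          have := mul_pos (sub_pos.2 hrk) (sub_pos.2 e6)
          linarith
        · have : c = n₁ + n₂ := by omega
          subst this
          have := mul_pos hr epos
          push_cast at h7
          linarith

theorem exists_scaledCost_le_unprotected (r : ℝ) (hk : k₁ ≤ k₂) (hn₁ : k₁ + 1 ≤ n₁)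
    (hn₂ : k₂ - k₁ + 1 ≤ n₂) (hn : (n₂ : ℝ) * (((k₁ : ℝ) + 1) / 2) ≤ (n₁ : ℝ))
    (hodd : k₁ % 2 = 1) (heven : n₂ * (k₂ + 1) % 2 = 0) :
    ∃ s : TwoLayerNetwork n₁ n₂, s.Resistant k₁ k₂ ∧ s.prot.card = 0 ∧
      s.scaledCost r ≤ (n₁ : ℝ) * (k₁ + 1) + n₂ * (k₂ + 1) := by
  obtain ⟨m, hm⟩ : ∃ m, k₁ + 1 = 2 * m := ⟨(k₁ + 1) / 2, by omega⟩
  obtain ⟨d, rfl⟩ := Nat.exists_eq_add_of_le hk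
  have hm' : (k₁ : ℝ) + 1 = 2 * m := by exact_mod_cast hm
  have hn' : n₂ * m ≤ n₁ := by
    rw [hm', mul_div_cancel_left₀ _ two_ne_zero] at hn
    exact_mod_cast hn
  -- As `k₁ + 1` is even, `n₂ * d` has the parity of `n₂ * (k₂ + 1)`.
  have hev : Even (n₂ * d) := by
    have h1 : n₂ * (k₁ + d + 1) = 2 * (n₂ * m) + n₂ * d := by
      rw [show k₁ + d + 1 = 2 * m + d by omega]; ring
    rw [Nat.even_iff]
    omega
  obtain ⟨s, hs, hp, hq⟩ := exists_resistant_unprotected (n₁ := n₁) (n₂ := n₂) (m := m) (d := d)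
    (by omega) (by omega) (by omega) hn' hev
  rw [show 2 * m - 1 = k₁ by omega] at hs
  refine ⟨s, hs, hp, ?_⟩
  have hq' : (2 : ℝ) * s.nonprot.card ≤ n₁ * (2 * m) + n₂ * (2 * m + d) := by exact_mod_cast hq
  rw [scaledCost, hp]
  push_cast
  rw [show (k₁ : ℝ) + d + 1 = 2 * m + d by linarith, hm']
  linarith

theorem exists_scaledCost_le_star (r : ℝ) (k₂ : ℕ) (hn₁ : k₁ + 1 ≤ n₁) (hn₂ : 1 ≤ n₂)
    (hodd : k₁ % 2 = 1) :
    ∃ s : TwoLayerNetwork n₁ n₂, s.Resistant k₁ k₂ ∧ s.prot.card = n₂ - 1 ∧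
      s.scaledCost r ≤ r * ((n₂ : ℝ) - 1) + ((n₁ : ℝ) + 1) * (k₁ + 1) := by
  obtain ⟨m, hm⟩ : ∃ m, k₁ + 1 = 2 * m := ⟨(k₁ + 1) / 2, by omega⟩
  have hm' : (k₁ : ℝ) + 1 = 2 * m := by exact_mod_cast hm
  obtain ⟨s, hs, hp, hq⟩ := exists_resistant_star (n₁ := n₁) (n₂ := n₂) (m := m) k₂ hn₂
    (by omega) (by omega)
  rw [show 2 * m - 1 = k₁ by omega] at hs
  refine ⟨s, hs, hp, ?_⟩
  have hq' : (s.nonprot.card : ℝ) ≤ (n₁ + 1) * m := by exact_mod_cast hq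
  rw [scaledCost, hp, Nat.cast_sub hn₂, hm']
  push_cast
  linarith

theorem exists_scaledCost_le_spanning_star (r : ℝ) (k₁ k₂ : ℕ) (hn₂ : 1 ≤ n₂) :
    ∃ s : TwoLayerNetwork n₁ n₂, s.Resistant k₁ k₂ ∧ s.prot.card = n₁ + n₂ - 1 ∧
      s.scaledCost r ≤ r * ((n₁ : ℝ) + n₂ - 1) := by
  obtain ⟨s, hs, hp, hq⟩ := exists_resistant_spanning_star (n₁ := n₁) k₁ k₂ hn₂
  refine ⟨s, hs, hp, ?_⟩
  rw [scaledCost, hp, hq, Nat.cast_sub (by omega)]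
  push_cast
  linarith

end TwoLayerNetwork

/-! ### The threshold rules -/

section Rules

open TwoLayerNetwork

variable {n₁ n₂ k₁ k₂ : ℕ} {cP cNP : ℝ}

theorem isSD_of_isOptimal (hcP : 0 < cP) (hcNP : 0 < cNP) (hk : k₁ ≤ k₂)
    (hn₁ : k₁ + 1 ≤ n₁) (hn₂ : k₂ - k₁ + 1 ≤ n₂)
    (hn : (n₂ : ℝ) * (((k₁ : ℝ) + 1) / 2) ≤ (n₁ : ℝ))
    (hodd : k₁ % 2 = 1) (heven : n₂ * (k₂ + 1) % 2 = 0)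
    {s : TwoLayerNetwork n₁ n₂} (hs : s.IsOptimal k₁ k₂ cP cNP) :
    s.IsSD k₁ k₂ 0 ∨ s.IsSD k₁ k₂ (n₂ - 1) ∨ s.IsSD k₁ k₂ (n₁ + n₂ - 1) := by
  have hr : 0 < 2 * (cP / cNP) := by positivity
  obtain ⟨s₀, r0, -, h0⟩ :=
    exists_scaledCost_le_unprotected (2 * (cP / cNP)) hk hn₁ hn₂ hn hodd heven
  obtain ⟨s₂, r2, -, h2⟩ :=
    exists_scaledCost_le_spanning_star (n₁ := n₁) (2 * (cP / cNP)) k₁ k₂ (by omega : 1 ≤ n₂)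
  have o0 := hs.scaledCost_le hcNP r0
  have o2 := hs.scaledCost_le hcNP r2
  have hsd := hs.isSD hcNP
  rcases hk.eq_or_lt with rfl | hlt
  · rcases hs.1.scaledCost_lower_bound_of_eq (by omega) hr with h | h | h | h
    · exact Or.inl (h.1 ▸ hsd)
    · exact Or.inr (Or.inr (h.1 ▸ hsd))
    · linarith
    · linarith
  · obtain ⟨s₁, r1, -, h1⟩ := exists_scaledCost_le_star (2 * (cP / cNP)) k₂ hn₁ (by omega : 1 ≤ n₂)
      hodd
    have o1 := hs.scaledCost_le hcNP r1
    rcases hs.1.scaledCost_lower_bound (by omega) hlt hr with h | h | h | h | h | h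
    · exact Or.inl (h.1 ▸ hsd)
    · exact Or.inr (Or.inl (h.1 ▸ hsd))
    · exact Or.inr (Or.inr (h.1 ▸ hsd))
    · linarith
    · linarith
    · linarith

theorem twoThresholdRule_of_lt (hcP : 0 < cP) (hcNP : 0 < cNP) (hk : k₁ < k₂)
    (hn₁ : k₁ + 1 ≤ n₁) (hn₂ : k₂ - k₁ + 1 ≤ n₂)
    (hn : (n₂ : ℝ) * (((k₁ : ℝ) + 1) / 2) ≤ (n₁ : ℝ))
    (hodd : k₁ % 2 = 1) (heven : n₂ * (k₂ + 1) % 2 = 0) :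
    TwoThresholdRule n₁ n₂ k₁ k₂ cP cNP := by
  have hr : 0 < 2 * (cP / cNP) := by positivity
  rw [TwoThresholdRule]
  have x0 := exists_scaledCost_le_unprotected (2 * (cP / cNP)) hk.le hn₁ hn₂ hn hodd heven
  have x1 := exists_scaledCost_le_star (2 * (cP / cNP)) k₂ hn₁ (by omega : 1 ≤ n₂) hodd
  have x2 := exists_scaledCost_le_spanning_star (n₁ := n₁) (2 * (cP / cNP)) k₁ k₂
    (by omega : 1 ≤ n₂)
  have lb : ∀ t : TwoLayerNetwork n₁ n₂, t.Resistant k₁ k₂ → _ := fun t ht =>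
    ht.scaledCost_lower_bound (by omega) hk hr
  have y0 : ∃ s : TwoLayerNetwork n₁ n₂, s.Resistant k₁ k₂ ∧ _ := x0.imp fun s h => ⟨h.1, h.2.2⟩
  have y1 : ∃ s : TwoLayerNetwork n₁ n₂, s.Resistant k₁ k₂ ∧ _ := x1.imp fun s h => ⟨h.1, h.2.2⟩
  have y2 : ∃ s : TwoLayerNetwork n₁ n₂, s.Resistant k₁ k₂ ∧ _ := x2.imp fun s h => ⟨h.1, h.2.2⟩
  have ek : (k₁ : ℝ) + 1 ≤ k₂ := by exact_mod_cast hk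
  have ek0 : (0 : ℝ) ≤ k₁ := Nat.cast_nonneg _
  have en₁ : (k₁ : ℝ) + 1 ≤ n₁ := by exact_mod_cast hn₁
  have en₂ : (2 : ℝ) ≤ n₂ := by exact_mod_cast (by omega : 2 ≤ n₂)
  have hn₁pos : (0 : ℝ) < n₁ := by linarith
  have hn₂pos : (0 : ℝ) < (n₂ : ℝ) - 1 := by linarith
  obtain ⟨T₁, hT₁⟩ : ∃ T, T = (k₂ : ℝ) + 1 + ((k₂ : ℝ) - k₁) / ((n₂ : ℝ) - 1) := ⟨_, rfl⟩
  obtain ⟨T₂, hT₂⟩ : ∃ T, T = (k₁ : ℝ) + 1 + ((k₁ : ℝ) + 1) / (n₁ : ℝ) := ⟨_, rfl⟩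
  -- At `r = T₁` the corner values for `0` and `n₂ - 1` protected links agree; at `r = T₂`, those
  -- for `n₂ - 1` and `n - 1`.
  have hT₁' : T₁ * ((n₂ : ℝ) - 1) = ((k₂ : ℝ) + 1) * ((n₂ : ℝ) - 1) + ((k₂ : ℝ) - k₁) := by
    rw [hT₁, add_mul, div_mul_cancel₀ _ hn₂pos.ne']
  have hT₂' : T₂ * (n₁ : ℝ) = ((k₁ : ℝ) + 1) * n₁ + ((k₁ : ℝ) + 1) := by
    rw [hT₂, add_mul, div_mul_cancel₀ _ hn₁pos.ne']
  -- Since `k₁ < k₂`, one has `T₂ ≤ k₁ + 2 ≤ k₂ + 1 < T₁`: the middle range is never empty.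
  have hT : T₂ < T₁ := by
    have h1 : ((k₁ : ℝ) + 1) / (n₁ : ℝ) ≤ 1 := (div_le_one hn₁pos).2 en₁
    have h2 : 0 < ((k₂ : ℝ) - k₁) / ((n₂ : ℝ) - 1) := div_pos (by linarith) hn₂pos
    linarith
  rw [← hT₁, ← hT₂]
  set r := 2 * (cP / cNP)
  refine ⟨fun h => ?_, fun h h' => ?_, fun h => ?_, fun h => ?_, fun h h' => ?_, fun h => ?_⟩
  · have c1 := mul_le_mul_of_nonneg_right h hn₂pos.le
    have c2 := mul_lt_mul_of_pos_right (hT.trans_le h) hn₁pos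
    refine sdOptimal_of_lower_bound hcNP x0 fun t ht => ?_
    rcases lb t ht with g | g | g | g | g | g <;> linarith
  · have c1 := mul_lt_mul_of_pos_right h' hn₂pos
    have c2 := mul_le_mul_of_nonneg_right h hn₁pos.le
    refine sdOptimal_of_lower_bound hcNP x1 fun t ht => ?_
    rcases lb t ht with g | g | g | g | g | g <;> linarith
  · have c1 := mul_lt_mul_of_pos_right (h.trans hT) hn₂pos
    have c2 := mul_lt_mul_of_pos_right h hn₁pos
    refine sdOptimal_of_lower_bound hcNP x2 fun t ht => ?_
    rcases lb t ht with g | g | g | g | g | g <;> linarith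
  · have c1 := mul_lt_mul_of_pos_right h hn₂pos
    have c2 := mul_lt_mul_of_pos_right (hT.trans h) hn₁pos
    refine onlySDOptimal_of_lower_bound hcNP y0 fun t ht => ?_
    rcases lb t ht with g | g | g | g | g | g <;> first | exact Or.inl g.1 | (right; linarith)
  · have c1 := mul_lt_mul_of_pos_right h' hn₂pos
    have c2 := mul_lt_mul_of_pos_right h hn₁pos
    refine onlySDOptimal_of_lower_bound hcNP y1 fun t ht => ?_
    rcases lb t ht with g | g | g | g | g | g <;> first | exact Or.inl g.1 | (right; linarith)
  · have c1 := mul_lt_mul_of_pos_right (h.trans hT) hn₂pos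
    have c2 := mul_lt_mul_of_pos_right h hn₁pos
    refine onlySDOptimal_of_lower_bound hcNP y2 fun t ht => ?_
    rcases lb t ht with g | g | g | g | g | g <;> first | exact Or.inl g.1 | (right; linarith)

theorem oneThresholdRule_of_eq (hcP : 0 < cP) (hcNP : 0 < cNP)
    (hn₁ : k₁ + 1 ≤ n₁) (hn₂ : 1 ≤ n₂)
    (hn : (n₂ : ℝ) * (((k₁ : ℝ) + 1) / 2) ≤ (n₁ : ℝ))
    (hodd : k₁ % 2 = 1) (heven : n₂ * (k₁ + 1) % 2 = 0) :
    OneThresholdRule n₁ n₂ k₁ k₁ cP cNP := by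
  have hr : 0 < 2 * (cP / cNP) := by positivity
  rw [OneThresholdRule]
  have x0 := exists_scaledCost_le_unprotected (2 * (cP / cNP)) le_rfl hn₁
    (by omega : k₁ - k₁ + 1 ≤ n₂) hn hodd heven
  have x2 := exists_scaledCost_le_spanning_star (n₁ := n₁) (2 * (cP / cNP)) k₁ k₁ hn₂
  have lb : ∀ t : TwoLayerNetwork n₁ n₂, t.Resistant k₁ k₁ → _ := fun t ht =>
    ht.scaledCost_lower_bound_of_eq hn₂ hr
  have y0 : ∃ s : TwoLayerNetwork n₁ n₂, s.Resistant k₁ k₁ ∧ _ := x0.imp fun s h => ⟨h.1, h.2.2⟩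
  have y2 : ∃ s : TwoLayerNetwork n₁ n₂, s.Resistant k₁ k₁ ∧ _ := x2.imp fun s h => ⟨h.1, h.2.2⟩
  have ek0 : (0 : ℝ) ≤ k₁ := Nat.cast_nonneg _
  have en₁ : (k₁ : ℝ) + 1 ≤ n₁ := by exact_mod_cast hn₁
  have en₂ : (1 : ℝ) ≤ n₂ := by exact_mod_cast hn₂
  have hpos : (0 : ℝ) < (n₁ : ℝ) + n₂ - 1 := by linarith
  obtain ⟨T, hT⟩ : ∃ T, T = ((n₁ : ℝ) * ((k₁ : ℝ) + 1) + (n₂ : ℝ) * ((k₁ : ℝ) + 1)) /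
    ((n₁ : ℝ) + (n₂ : ℝ) - 1) := ⟨_, rfl⟩
  have hT' : T * ((n₁ : ℝ) + n₂ - 1) =
      (n₁ : ℝ) * ((k₁ : ℝ) + 1) + (n₂ : ℝ) * ((k₁ : ℝ) + 1) := by
    rw [hT, div_mul_cancel₀ _ hpos.ne']
  rw [← hT]
  refine ⟨fun h => ?_, fun h => ?_, fun h s hs hopt => ?_, fun h => ?_, fun h => ?_⟩
  · have c := mul_le_mul_of_nonneg_right h hpos.le
    refine sdOptimal_of_lower_bound hcNP x0 fun t ht => ?_
    rcases lb t ht with g | g | g | g <;> linarith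
  · have c := mul_lt_mul_of_pos_right h hpos
    refine sdOptimal_of_lower_bound hcNP x2 fun t ht => ?_
    rcases lb t ht with g | g | g | g <;> linarith
  · obtain ⟨s₀, r0, h0⟩ := y0
    obtain ⟨s₂, r2, h2⟩ := y2
    have o0 := hopt.scaledCost_le hcNP r0
    have o2 := hopt.scaledCost_le hcNP r2
    have hp := hs.2.1
    -- For `n₂ ≥ 2` the number `n₂ - 1` is neither `0` nor `n - 1`, so `s` is strictly beaten by one
    -- of the two extreme networks.
    rcases lb s hs.1 with g | g | g | g
    · omega
    · omega
    · linarith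
    · linarith
  · have c := mul_lt_mul_of_pos_right h hpos
    refine onlySDOptimal_of_lower_bound hcNP y0 fun t ht => ?_
    rcases lb t ht with g | g | g | g <;> first | exact Or.inl g.1 | (right; linarith)
  · have c := mul_lt_mul_of_pos_right h hpos
    refine onlySDOptimal_of_lower_bound hcNP y2 fun t ht => ?_
    rcases lb t ht with g | g | g | g <;> first | exact Or.inl g.1 | (right; linarith)

end Rules

theorem proposition3 (n₁ n₂ k₁ k₂ : ℕ) (cP cNP : ℝ)
    (hcP : 0 < cP) (hcNP : 0 < cNP)
    (hk : k₁ ≤ k₂)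
    (hn₁ : k₁ + 1 ≤ n₁) (hn₂ : k₂ - k₁ + 1 ≤ n₂)
    (hn : (n₂ : ℝ) * (((k₁ : ℝ) + 1) / 2) ≤ (n₁ : ℝ))
    (hodd : k₁ % 2 = 1) (heven : n₂ * (k₂ + 1) % 2 = 0) :
    -- every optimal network is an `s^D_0`, an `s^D_{n₂-1}` or an `s^D_{n-1}`
    (∀ s : TwoLayerNetwork n₁ n₂, s.IsOptimal k₁ k₂ cP cNP →
      s.IsSD k₁ k₂ 0 ∨ s.IsSD k₁ k₂ (n₂ - 1) ∨ s.IsSD k₁ k₂ (n₁ + n₂ - 1)) ∧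
    -- Regime I
    (1 + (k₁ : ℝ) - ((n₁ : ℝ) + n₂) * ((k₂ : ℝ) - k₁) ≤ 0 →
      TwoThresholdRule n₁ n₂ k₁ k₂ cP cNP) ∧
    -- Regime II
    (0 < 1 + (k₁ : ℝ) - ((n₁ : ℝ) + n₂) * ((k₂ : ℝ) - k₁) →
      ((n₂ : ℝ) < (1 + (k₁ : ℝ)) / (1 + (k₁ : ℝ) - (n₁ : ℝ) * ((k₂ : ℝ) - k₁)) →
        TwoThresholdRule n₁ n₂ k₁ k₂ cP cNP) ∧
      ((1 + (k₁ : ℝ)) / (1 + (k₁ : ℝ) - (n₁ : ℝ) * ((k₂ : ℝ) - k₁)) ≤ (n₂ : ℝ) →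
        OneThresholdRule n₁ n₂ k₁ k₂ cP cNP)) := by
  refine ⟨fun s hs => isSD_of_isOptimal hcP hcNP hk hn₁ hn₂ hn hodd heven hs, fun h => ?_,
    fun h => ⟨fun h' => ?_, fun _ => ?_⟩⟩
  · refine twoThresholdRule_of_lt hcP hcNP (hk.lt_of_ne ?_) hn₁ hn₂ hn hodd heven
    rintro rfl
    have : (0 : ℝ) ≤ k₁ := Nat.cast_nonneg _
    linarith
  · refine twoThresholdRule_of_lt hcP hcNP (hk.lt_of_ne ?_) hn₁ hn₂ hn hodd heven
    rintro rfl
    -- Equal levels make the quotient `1`, which would leave no node of type 2.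
    have h1 : (1 : ℝ) + k₁ ≠ 0 := by positivity
    rw [sub_self, mul_zero, sub_zero, div_self h1] at h'
    have : n₂ < 1 := by exact_mod_cast h'
    omega
  · -- in this regime the two levels of resistance coincide
    obtain rfl : k₁ = k₂ := by
      by_contra hne
      have e1 : (k₁ : ℝ) + 1 ≤ k₂ := by exact_mod_cast hk.lt_of_ne hne
      have e2 : (k₁ : ℝ) + 1 ≤ n₁ := by exact_mod_cast hn₁
      have e3 : (0 : ℝ) ≤ n₂ := Nat.cast_nonneg _
      have e4 : (0 : ℝ) ≤ k₁ := Nat.cast_nonneg _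
      -- If `k₂ - k₁ ≥ 1`, then `(n₁ + n₂)(k₂ - k₁) ≥ n₁ ≥ k₁ + 1`, against the inequality that
      -- defines Regime II.
      have := mul_nonneg (by linarith : (0 : ℝ) ≤ (n₁ : ℝ) + n₂)
        (by linarith : (0 : ℝ) ≤ (k₂ : ℝ) - k₁ - 1)
      linarith
    exact oneThresholdRule_of_eq hcP hcNP hn₁ (by omega) hn hodd heven
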